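/- Let $E$ be a complex Banach space with topological dual $E'$. For $j\in\mathbb N_0$ let $\mathcal P({}^jE)$ be the space of continuous $j$-homogeneous polynomials $E\to\mathbb C$, and let $\mathcal P_f({}^jE)$ be the linear span of the polynomials $\varphi^j\cdot b$ ($\varphi\in E'$, $b\in\mathbb C$). For $f$ holomorphic near $a\in E$, let $\hat d^jf(a)\in\mathcal P({}^jE)$ be the $j$-th derivative of $f$ at $a$, regarded as the $j$-homogeneous polynomial $x\mapsto D^jf(a)(x,\dots,x)$. A holomorphy type $\Theta$ from $E$ to $\mathbb C$ is a sequence of Banach spaces $(\mathcal P_\Theta({}^jE),\|\cdot\|_\Theta)_{j\ge 0}$ such that each $\mathcal P_\Theta({}^jE)$ is a vector subspace of $\mathcal P({}^jE)$, $\mathcal P_\Theta({}^0E)=\mathbb C$ as a normed space, and, for some real $\sigma\ge 1$, whenever $0\le i\le j$, $a\in E$ and $P\in\mathcal P_\Theta({}^jE)$, one has $\hat d^iP(a)\in\mathcal P_\Theta({}^iE)$ and $\big\|\tfrac1{i!}\hat d^iP(a)\big\|_\Theta\le\sigma^j\|P\|_\Theta\|a\|^{j-i}$. It is a $\pi_1$-holomorphy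 type if, in addition, $\mathcal P_f({}^jE)$ is contained in $\mathcal P_\Theta({}^jE)$ and is $\|\cdot\|_\Theta$-dense in it for every $j\ge0$, and there is $K>0$ such that $\|\varphi^j\cdot b\|_\Theta\le K^j\|\varphi\|^j|b|$ for all $\varphi\in E'$, $b\in\mathbb C$ and $j\ge0$. For a holomorphy type $\Theta$ and $k\in[1,\infty)$, let $Exp^k_{\Theta,0}(E)$ be the space of all entire $f:E\to\mathbb C$ such that $\hat d^jf(0)\in\mathcal P_\Theta({}^jE)$ for all $j\ge0$ and, for every $\rho>0$, $$\|f\|_{\Theta,k,\rho}=\sum_{j=0}^\infty\rho^{-j}\Big(\frac{j}{ke}\Big)^{j/k}\Big\|\tfrac1{j!}\hat d^jf(0)\Big\|_\Theta<\infty$$ (the factor $(j/(ke))^{j/k}$ being $1$ for $j=0$), with the locally convex topology generated by the norms $\|\cdot\|_{\Theta,k,\rho}$, $\rho>0$. Let $Exp^\infty_{\Theta,0}(E)$ be the space of all entire $f:E\to\mathbb C$ such that $\hat d^jf(0)\in\mathcal P_\Theta({}^jE)$ for all $j\ge0$ and $\limsup_{j\to\infty}\big\|\tfrac1{j!}\hat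 d^jf(0)\big\|_\Theta^{1/j}=0$, with the locally convex topology generated by the norms $\sum_{j\ge0}\rho^{-j}\big\|\tfrac1{j!}\hat d^jf(0)\big\|_\Theta$, $\rho>0$. A convolution operator on $Exp^k_{\Theta,0}(E)$ is a continuous linear map $L$ of this space into itself such that $d(Lf)(\cdot)a=L(df(\cdot)a)$ for all $a\in E$ and $f\in Exp^k_{\Theta,0}(E)$, where $df(\cdot)a$ denotes the directional derivative of $f$ in the direction $a$. **Theorem.** Let $k\in(1,\infty]$, let $E'$ be separable (in its norm topology), and let $\Theta$ be a $\pi_1$-holomorphy type from $E$ to $\mathbb C$. Then every convolution operator $L$ on $Exp^k_{\Theta,0}(E)$ that is not a scalar multiple of the identity is mixing (for all non-empty open sets $U,V$ there is $n_0$ such that $L^n(U)\cap V\ne\emptyset$ for all $n\ge n_0$) and, in particular, hypercyclic (there is $f$ whose orbit $\{f,Lf,L^2f,\dots\}$ is dense). -/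

import Mathlib

open Filter Topology
open scoped ENNReal

/-- The space `P(^j E)` of continuous `j`-homogeneous polynomials `E → ℂ`: the functions
`x ↦ B (x, …, x)` with `B` a continuous `j`-linear form. -/
def homPoly (E : Type*) [NormedAddCommGroup E] [NormedSpace ℂ E] (j : ℕ) :
    Submodule ℂ (E → ℂ) where
  carrier := {P | ∃ B : ContinuousMultilinearMap ℂ (fun _ : Fin j => E) ℂ,
    ∀ x, P x = B (fun _ => x)}
  zero_mem' := ⟨0, fun _ => rfl⟩
  add_mem' := by
    rintro P Q ⟨B, hB⟩ ⟨C, hC⟩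
    exact ⟨B + C, fun x => by simp [hB, hC]⟩
  smul_mem' := by
    rintro c P ⟨B, hB⟩
    exact ⟨c • B, fun x => by simp [hB]⟩

/-- The space `P_f(^j E)` of polynomials of finite type: the span of the `φ ^ j · b` with
`φ ∈ E'` and `b ∈ ℂ`. -/
def finiteTypePoly (E : Type*) [NormedAddCommGroup E] [NormedSpace ℂ E] (j : ℕ) :
    Submodule ℂ (E → ℂ) :=
  Submodule.span ℂ {P | ∃ (φ : StrongDual ℂ E) (b : ℂ), P = fun x => φ x ^ j * b}

/-- The `j`-th derivative of `f` at `a` as a `j`-homogeneous polynomial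
`x ↦ D^j f(a)(x, …, x)`. -/
noncomputable def polyDeriv {E : Type*} [NormedAddCommGroup E] [NormedSpace ℂ E]
    (j : ℕ) (f : E → ℂ) (a : E) : E → ℂ :=
  fun x => iteratedFDeriv ℂ j f a (fun _ => x)

/-- The `j`-th Taylor polynomial `(1 / j!) d^j f(a)` of `f` at `a`. -/
noncomputable def taylorPoly {E : Type*} [NormedAddCommGroup E] [NormedSpace ℂ E]
    (j : ℕ) (f : E → ℂ) (a : E) : E → ℂ :=
  ((Nat.factorial j : ℕ) : ℂ)⁻¹ • polyDeriv j f a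

/-- A holomorphy type from `E` to `ℂ`: a sequence of Banach spaces `P_Θ(^j E)`, each a vector
subspace `space j` of `P(^j E)` with its own complete norm `thetaNorm j` (only the values of
`thetaNorm j` on `space j` carry any meaning). -/
structure HolomorphyType (E : Type*) [NormedAddCommGroup E] [NormedSpace ℂ E] where
  /-- The vector space `P_Θ(^j E)`. -/
  space : ℕ → Submodule ℂ (E → ℂ)
  /-- The norm of `P_Θ(^j E)`. -/
  thetaNorm : ℕ → (E → ℂ) → ℝ
  space_le : ∀ j, space j ≤ homPoly E j
  norm_add_le : ∀ j, ∀ P ∈ space j, ∀ Q ∈ space j,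
    thetaNorm j (P + Q) ≤ thetaNorm j P + thetaNorm j Q
  norm_smul : ∀ j, ∀ c : ℂ, ∀ P ∈ space j, thetaNorm j (c • P) = ‖c‖ * thetaNorm j P
  eq_zero_of_norm : ∀ j, ∀ P ∈ space j, thetaNorm j P = 0 → P = 0
  complete : ∀ j, ∀ u : ℕ → E → ℂ, (∀ n, u n ∈ space j) →
    (∀ ε > (0 : ℝ), ∃ N, ∀ m ≥ N, ∀ n ≥ N, thetaNorm j (u m - u n) < ε) →
    ∃ P ∈ space j, Tendsto (fun n => thetaNorm j (u n - P)) atTop (𝓝 0)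
  /-- `P_Θ(^0 E)` consists of all constants … -/
  const_mem : ∀ b : ℂ, (fun _ => b) ∈ space 0
  /-- … with the norm of `ℂ`. -/
  norm_const : ∀ b : ℂ, thetaNorm 0 (fun _ => b) = ‖b‖
  deriv_bound : ∃ σ : ℝ, 1 ≤ σ ∧ ∀ i j : ℕ, i ≤ j → ∀ a : E, ∀ P ∈ space j,
    polyDeriv i P a ∈ space i ∧
      thetaNorm i (taylorPoly i P a) ≤ σ ^ j * thetaNorm j P * ‖a‖ ^ (j - i)

namespace HolomorphyType

variable {E : Type*} [NormedAddCommGroup E] [NormedSpace ℂ E]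

/-- `Θ` is a `π₁`-holomorphy type. -/
def IsPiOne (Θ : HolomorphyType E) : Prop :=
  (∀ j, finiteTypePoly E j ≤ Θ.space j) ∧
  (∃ K : ℝ, 0 < K ∧ ∀ (j : ℕ) (φ : StrongDual ℂ E) (b : ℂ),
    Θ.thetaNorm j (fun x => φ x ^ j * b) ≤ K ^ j * ‖φ‖ ^ j * ‖b‖) ∧
  (∀ j, ∀ P ∈ Θ.space j, ∀ ε > (0 : ℝ),
    ∃ Q ∈ finiteTypePoly E j, Θ.thetaNorm j (P - Q) < ε)

theorem norm_zero (Θ : HolomorphyType E) (j : ℕ) : Θ.thetaNorm j 0 = 0 := by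
  simpa using Θ.norm_smul j 0 0 (Submodule.zero_mem _)

theorem norm_nonneg (Θ : HolomorphyType E) {j : ℕ} {P : E → ℂ} (hP : P ∈ Θ.space j) :
    0 ≤ Θ.thetaNorm j P := by
  have h := Θ.norm_add_le j P hP ((-1 : ℂ) • P) (Submodule.smul_mem _ _ hP)
  rw [Θ.norm_smul j _ P hP] at h
  have h0 : P + (-1 : ℂ) • P = 0 := by simp
  rw [h0, Θ.norm_zero] at h
  simp at h
  linarith

end HolomorphyType

/-- The weight `(j / (k e)) ^ (j / k)` for `k < ∞` (equal to `1` at `j = 0`), and `1` for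
`k = ∞`. -/
noncomputable def expWeight (k : ℝ≥0∞) (j : ℕ) : ℝ :=
  if k = ⊤ then 1 else ((j : ℝ) / (k.toReal * Real.exp 1)) ^ ((j : ℝ) / k.toReal)

theorem expWeight_nonneg (k : ℝ≥0∞) (j : ℕ) : 0 ≤ expWeight k j := by
  unfold expWeight
  split_ifs
  · exact zero_le_one
  · positivity

section ExpSpace

variable {E : Type*} [NormedAddCommGroup E] [NormedSpace ℂ E]

/-- The `j`-th term `ρ^{-j} (j / (k e))^{j / k} ‖(1 / j!) d^j f(0)‖_Θ` (without the middle
factor when `k = ∞`) of the series defining `‖f‖_{Θ, k, ρ}`. -/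
noncomputable def expTerm (Θ : HolomorphyType E) (k : ℝ≥0∞) (ρ : ℝ) (f : E → ℂ) (j : ℕ) : ℝ :=
  (ρ ^ j)⁻¹ * expWeight k j * Θ.thetaNorm j (taylorPoly j f 0)

/-- The norm `‖f‖_{Θ, k, ρ}` (for `k = ∞`, the norm `p_{Θ, ρ}^∞ (f)`). -/
noncomputable def expNorm (Θ : HolomorphyType E) (k : ℝ≥0∞) (ρ : ℝ) (f : E → ℂ) : ℝ :=
  ∑' j, expTerm Θ k ρ f j

/-- Membership in `Exp^k_{Θ,0}(E)`: `f` is entire, all its derivatives at `0` belong to `Θ`, and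
* for `k < ∞`, the series defining `‖f‖_{Θ, k, ρ}` converges for every `ρ > 0`, that is,
  `f` lies in the intersection of the spaces `B^k_{Θ, ρ}(E)`;
* for `k = ∞`, `limsup ‖(1 / j!) d^j f(0)‖_Θ ^ (1 / j) ≤ 0`. -/
def MemExp (Θ : HolomorphyType E) (k : ℝ≥0∞) (f : E → ℂ) : Prop :=
  AnalyticOnNhd ℂ f Set.univ ∧ (∀ j, polyDeriv j f 0 ∈ Θ.space j) ∧
    if k = ⊤ then
      limsup (fun j : ℕ => ENNReal.ofReal (Θ.thetaNorm j (taylorPoly j f 0)) ^ ((1 : ℝ) / j))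
        atTop ≤ 0
    else ∀ ρ : ℝ, 0 < ρ → Summable (expTerm Θ k ρ f)

theorem limsup_root_le_zero_iff {c : ℕ → ℝ} (hc : ∀ j, 0 ≤ c j) :
    limsup (fun j : ℕ => ENNReal.ofReal (c j) ^ ((1 : ℝ) / j)) atTop ≤ 0 ↔
      ∀ ρ : ℝ, 0 < ρ → Summable (fun j => (ρ ^ j)⁻¹ * c j) := by
  constructor
  · intro h ρ hρ
    have h2 : limsup (fun j : ℕ => ENNReal.ofReal (c j) ^ ((1 : ℝ) / j)) atTop <
        ENNReal.ofReal (ρ / 2) := lt_of_le_of_lt h (by simp [hρ])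
    have hev := eventually_lt_of_limsup_lt h2
    refine Summable.of_norm_bounded_eventually_nat (g := fun j : ℕ => ((1 : ℝ) / 2) ^ j)
      (summable_geometric_of_lt_one (by norm_num) (by norm_num)) ?_
    filter_upwards [hev, eventually_gt_atTop 0] with j hj hj0
    have hjr : (0 : ℝ) < j := by exact_mod_cast hj0
    have h3 := ENNReal.rpow_le_rpow hj.le hjr.le
    rw [← ENNReal.rpow_mul, one_div_mul_cancel hjr.ne', ENNReal.rpow_one,
      ENNReal.rpow_natCast, ← ENNReal.ofReal_pow (by positivity),
      ENNReal.ofReal_le_ofReal_iff (by positivity)] at h3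
    rw [Real.norm_of_nonneg (mul_nonneg (by positivity) (hc j))]
    calc (ρ ^ j)⁻¹ * c j ≤ (ρ ^ j)⁻¹ * (ρ / 2) ^ j := by gcongr
      _ = (1 / 2) ^ j := by rw [div_pow, div_pow, one_pow]; field_simp
  · intro h
    refine ENNReal.le_of_forall_pos_le_add fun ε hε _ => ?_
    rw [zero_add]
    have hε' : (0 : ℝ) < ε := by exact_mod_cast hε
    have ht := (h ε hε').tendsto_atTop_zero
    refine limsup_le_of_le (by isBoundedDefault) ?_
    filter_upwards [ht.eventually (gt_mem_nhds (zero_lt_one)), eventually_gt_atTop 0]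
      with j hj hj0
    have hjr : (0 : ℝ) < j := by exact_mod_cast hj0
    have h4 : c j ≤ (ε : ℝ) ^ j := by
      rw [inv_mul_lt_iff₀ (by positivity), mul_one] at hj
      exact hj.le
    have h5 : ENNReal.ofReal (c j) ≤ (ε : ℝ≥0∞) ^ j := by
      refine (ENNReal.ofReal_le_ofReal h4).trans ?_
      rw [ENNReal.ofReal_pow hε'.le, ENNReal.ofReal_coe_nnreal]
    refine (ENNReal.rpow_le_rpow h5 (by positivity)).trans ?_
    rw [← ENNReal.rpow_natCast, ← ENNReal.rpow_mul, mul_one_div_cancel hjr.ne',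
      ENNReal.rpow_one]

theorem taylorPoly_mem (Θ : HolomorphyType E) {f : E → ℂ} {j : ℕ}
    (h : polyDeriv j f 0 ∈ Θ.space j) : taylorPoly j f 0 ∈ Θ.space j :=
  Submodule.smul_mem _ _ h

theorem memExp_iff (Θ : HolomorphyType E) (k : ℝ≥0∞) (f : E → ℂ) :
    MemExp Θ k f ↔ AnalyticOnNhd ℂ f Set.univ ∧ (∀ j, polyDeriv j f 0 ∈ Θ.space j) ∧
      ∀ ρ : ℝ, 0 < ρ → Summable (expTerm Θ k ρ f) := by
  unfold MemExp
  refine and_congr_right fun _ => and_congr_right fun h => ?_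
  split_ifs with hk
  · rw [limsup_root_le_zero_iff fun j => Θ.norm_nonneg (taylorPoly_mem Θ (h j))]
    have h1 : ∀ ρ, expTerm Θ k ρ f =
        fun j => (ρ ^ j)⁻¹ * Θ.thetaNorm j (taylorPoly j f 0) := fun ρ => by
      funext j
      simp [expTerm, expWeight, hk]
    simp only [h1]
  · rfl

theorem polyDeriv_add {f g : E → ℂ} (hf : AnalyticOnNhd ℂ f Set.univ)
    (hg : AnalyticOnNhd ℂ g Set.univ) (j : ℕ) :
    polyDeriv j (f + g) 0 = polyDeriv j f 0 + polyDeriv j g 0 := by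
  funext x
  simp only [polyDeriv, Pi.add_apply]
  rw [iteratedFDeriv_add_apply (hf 0 trivial).contDiffAt (hg 0 trivial).contDiffAt]
  rfl

theorem polyDeriv_smul {f : E → ℂ} (hf : AnalyticOnNhd ℂ f Set.univ) (c : ℂ) (j : ℕ) :
    polyDeriv j (c • f) 0 = c • polyDeriv j f 0 := by
  funext x
  simp only [polyDeriv, Pi.smul_apply]
  rw [iteratedFDeriv_const_smul_apply (hf 0 trivial).contDiffAt]
  rfl

theorem polyDeriv_zero (j : ℕ) : polyDeriv j (0 : E → ℂ) 0 = 0 := by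
  simpa using polyDeriv_smul (f := (0 : E → ℂ)) analyticOnNhd_const 0 j

theorem expTerm_nonneg (Θ : HolomorphyType E) (k : ℝ≥0∞) {ρ : ℝ} (hρ : 0 < ρ) {f : E → ℂ}
    {j : ℕ} (h : polyDeriv j f 0 ∈ Θ.space j) : 0 ≤ expTerm Θ k ρ f j :=
  mul_nonneg (mul_nonneg (by positivity) (expWeight_nonneg k j))
    (Θ.norm_nonneg (taylorPoly_mem Θ h))

theorem expTerm_add_le (Θ : HolomorphyType E) (k : ℝ≥0∞) {ρ : ℝ} (hρ : 0 < ρ) {f g : E → ℂ}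
    (hf : AnalyticOnNhd ℂ f Set.univ) (hg : AnalyticOnNhd ℂ g Set.univ) {j : ℕ}
    (hf' : polyDeriv j f 0 ∈ Θ.space j) (hg' : polyDeriv j g 0 ∈ Θ.space j) :
    expTerm Θ k ρ (f + g) j ≤ expTerm Θ k ρ f j + expTerm Θ k ρ g j := by
  have h : taylorPoly j (f + g) 0 = taylorPoly j f 0 + taylorPoly j g 0 := by
    simp only [taylorPoly, polyDeriv_add hf hg, smul_add]
  unfold expTerm
  rw [h, ← mul_add]
  exact mul_le_mul_of_nonneg_left
    (Θ.norm_add_le j _ (taylorPoly_mem Θ hf') _ (taylorPoly_mem Θ hg'))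
    (mul_nonneg (by positivity) (expWeight_nonneg k j))

theorem expTerm_smul (Θ : HolomorphyType E) (k : ℝ≥0∞) (ρ : ℝ) (c : ℂ) {f : E → ℂ}
    (hf : AnalyticOnNhd ℂ f Set.univ) {j : ℕ} (hf' : polyDeriv j f 0 ∈ Θ.space j) :
    expTerm Θ k ρ (c • f) j = ‖c‖ * expTerm Θ k ρ f j := by
  have h : taylorPoly j (c • f) 0 = c • taylorPoly j f 0 := by
    simp only [taylorPoly, polyDeriv_smul hf, smul_comm c]
  unfold expTerm
  rw [h, Θ.norm_smul j c _ (taylorPoly_mem Θ hf')]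
  ring

/-- `Exp^k_{Θ,0}(E)` as a vector space of functions. -/
def expSubmodule (Θ : HolomorphyType E) (k : ℝ≥0∞) : Submodule ℂ (E → ℂ) where
  carrier := {f | MemExp Θ k f}
  zero_mem' := by
    refine (memExp_iff Θ k 0).2 ⟨analyticOnNhd_const, fun j => ?_, fun ρ _ => ?_⟩
    · rw [polyDeriv_zero]; exact Submodule.zero_mem _
    · have h : expTerm Θ k ρ (0 : E → ℂ) = fun _ => 0 := by
        funext j
        simp [expTerm, taylorPoly, polyDeriv_zero, Θ.norm_zero]
      rw [h]
      exact summable_zero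
  add_mem' := by
    intro f g hf hg
    obtain ⟨hfa, hfm, hfs⟩ := (memExp_iff Θ k f).1 hf
    obtain ⟨hga, hgm, hgs⟩ := (memExp_iff Θ k g).1 hg
    have hm : ∀ j, polyDeriv j (f + g) 0 ∈ Θ.space j := fun j => by
      rw [polyDeriv_add hfa hga]; exact Submodule.add_mem _ (hfm j) (hgm j)
    exact (memExp_iff Θ k _).2 ⟨hfa.add hga, hm, fun ρ hρ =>
      Summable.of_nonneg_of_le (fun j => expTerm_nonneg Θ k hρ (hm j))
        (fun j => expTerm_add_le Θ k hρ hfa hga (hfm j) (hgm j))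
        ((hfs ρ hρ).add (hgs ρ hρ))⟩
  smul_mem' := by
    intro c f hf
    obtain ⟨hfa, hfm, hfs⟩ := (memExp_iff Θ k f).1 hf
    refine (memExp_iff Θ k _).2 ⟨fun x hx => (hfa x hx).const_smul, fun j => ?_, fun ρ hρ => ?_⟩
    · rw [polyDeriv_smul hfa]; exact Submodule.smul_mem _ _ (hfm j)
    · exact ((hfs ρ hρ).mul_left ‖c‖).congr fun j =>
        (expTerm_smul Θ k ρ c hfa (hfm j)).symm

/-- The space `Exp^k_{Θ,0}(E)`. (A type of its own, so that it carries the topology defined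
below and not the topology of pointwise convergence.) -/
def ExpSpace (Θ : HolomorphyType E) (k : ℝ≥0∞) : Type _ := expSubmodule Θ k

noncomputable instance (Θ : HolomorphyType E) (k : ℝ≥0∞) : AddCommGroup (ExpSpace Θ k) :=
  inferInstanceAs (AddCommGroup (expSubmodule Θ k))

noncomputable instance (Θ : HolomorphyType E) (k : ℝ≥0∞) : Module ℂ (ExpSpace Θ k) :=
  inferInstanceAs (Module ℂ (expSubmodule Θ k))

/-- The entire function underlying an element of `Exp^k_{Θ,0}(E)`. -/
def ExpSpace.toFun {Θ : HolomorphyType E} {k : ℝ≥0∞} (f : ExpSpace Θ k) : E → ℂ :=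
  Subtype.val (p := fun g => g ∈ expSubmodule Θ k) f

instance (Θ : HolomorphyType E) (k : ℝ≥0∞) : CoeFun (ExpSpace Θ k) (fun _ => E → ℂ) :=
  ⟨ExpSpace.toFun⟩

theorem ExpSpace.memExp {Θ : HolomorphyType E} {k : ℝ≥0∞} (f : ExpSpace Θ k) :
    MemExp Θ k f := Subtype.property (p := fun g => g ∈ expSubmodule Θ k) f

/-- The norms `f ↦ ‖f‖_{Θ, k, ρ}`, `ρ > 0`, on `Exp^k_{Θ,0}(E)`. -/
noncomputable def expSeminorm (Θ : HolomorphyType E) (k : ℝ≥0∞) :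
    SeminormFamily ℂ (ExpSpace Θ k) {ρ : ℝ // 0 < ρ} := fun ρ =>
  Seminorm.of (fun f => expNorm Θ k ρ f)
    (fun f g => by
      obtain ⟨hfa, hfm, hfs⟩ := (memExp_iff Θ k f).1 f.memExp
      obtain ⟨hga, hgm, hgs⟩ := (memExp_iff Θ k g).1 g.memExp
      obtain ⟨_, _, hs⟩ := (memExp_iff Θ k (f + g : ExpSpace Θ k)).1 (f + g).memExp
      show (∑' j, _) ≤ (∑' j, _) + ∑' j, _
      rw [← (hfs ρ ρ.2).tsum_add (hgs ρ ρ.2)]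
      exact (hs ρ ρ.2).tsum_le_tsum
        (fun j => expTerm_add_le Θ k ρ.2 hfa hga (hfm j) (hgm j))
        ((hfs ρ ρ.2).add (hgs ρ ρ.2)))
    (fun c f => by
      obtain ⟨hfa, hfm, _⟩ := (memExp_iff Θ k f).1 f.memExp
      show (∑' j, _) = ‖c‖ * ∑' j, _
      rw [← tsum_mul_left]
      exact tsum_congr fun j => expTerm_smul Θ k ρ c hfa (hfm j))

/-- The locally convex topology of `Exp^k_{Θ,0}(E)`: it is generated by the norms
`‖·‖_{Θ, k, ρ}`, `ρ > 0`. -/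
noncomputable instance (Θ : HolomorphyType E) (k : ℝ≥0∞) : TopologicalSpace (ExpSpace Θ k) :=
  letI : Nonempty {ρ : ℝ // 0 < ρ} := ⟨⟨1, one_pos⟩⟩
  (expSeminorm Θ k).moduleFilterBasis.topology

theorem withSeminorms_expSeminorm (Θ : HolomorphyType E) (k : ℝ≥0∞) :
    WithSeminorms (expSeminorm Θ k) := ⟨rfl⟩

/-- A convolution operator on `Exp^k_{Θ,0}(E)`: a continuous linear operator `L` with
`d(Lf)(·)a = L(df(·)a)` for all `a ∈ E` and `f`. Here `g` is the directional derivative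
`df(·)a`, seen as an element of `Exp^k_{Θ,0}(E)`. -/
def IsConvolutionOperator {Θ : HolomorphyType E} {k : ℝ≥0∞}
    (L : ExpSpace Θ k →L[ℂ] ExpSpace Θ k) : Prop :=
  ∀ (a : E) (f g : ExpSpace Θ k), (∀ x, g x = fderiv ℂ f x a) →
    ∀ x, (L g) x = fderiv ℂ (L f) x a

end ExpSpace

/-- A self-map `T` of a topological space is mixing if for all non-empty open `U`, `V` there is
`n₀` with `T^n(U) ∩ V ≠ ∅` for all `n ≥ n₀`. -/
def IsMixingMap {X : Type*} [TopologicalSpace X] (T : X → X) : Prop :=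
  ∀ U V : Set X, IsOpen U → IsOpen V → U.Nonempty → V.Nonempty →
    ∃ n₀ : ℕ, ∀ n ≥ n₀, (T^[n] '' U ∩ V).Nonempty

/-- `T` is hypercyclic if some orbit `{x, T x, T² x, …}` is dense. -/
def IsHypercyclicMap {X : Type*} [TopologicalSpace X] (T : X → X) : Prop :=
  ∃ x : X, Dense (Set.range fun n : ℕ => T^[n] x)

/-!
Every exponential `e ^ φ`, `φ ∈ E'`, lies in `Exp^k_{Θ,0}(E)`: this is where `k > 1` enters, since
the weight `(j / (k e)) ^ (j / k)` is at most `(j !) ^ (1 / k)` and is beaten by the `1 / j !` of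
the exponential series. If `L` is a convolution operator, then `g = L (e ^ φ)` satisfies
`dg(x) a = φ(a) g(x)`, hence `L (e ^ φ) = F(φ) e ^ φ` with the symbol `F(φ) = L (e ^ φ) (0)`.

For a continuous linear functional `T` the function `φ ↦ T (e ^ φ)` is continuous on `E'` and entire
along complex lines (`differentiable_apply_exponential`, `continuous_apply_exponential`), and if it
vanishes identically then so do all `T (φ ^ j)`, hence `T = 0`, because the polynomials of finite
type are `Θ`-dense and Taylor series converge in `Exp^k_{Θ,0}(E)`
(`eq_zero_of_apply_exponential_eq_zero`). By Hahn–Banach and the identity theorem, the exponentials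
`e ^ φ` with `φ` in a non-empty open subset of `E'` span a dense subspace
(`dense_span_exponential_of_isOpen`).

If the symbol were constant, `L` would be a multiple of the identity. As it is not, Liouville's
theorem on complex lines, applied to `F` and to `1 / F`, shows that the open sets `{|F| > 1}` and
`{|F| < 1}` are non-empty. So the eigenvectors of `L` with eigenvalue of modulus `> 1`, and
those with eigenvalue of modulus `< 1`, both span dense subspaces, and the Godefroy–Shapiro
argument (`isMixingMap_of_dense_span_eigenvectors`) gives that `L` is mixing.

Hypercyclicity follows by Birkhoff's transitivity theorem (`IsMixingMap.isHypercyclicMap`), once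
`Exp^k_{Θ,0}(E)` is known to be a separable Fréchet space. Separability comes from that of `E'`.
For completeness one has to see that a Taylor series with coefficients in the `P_Θ(^j E)` and finite
norms is the Taylor series of an entire function; the pointwise bound
`|P(x)| ≤ σ ^ j ‖P‖_Θ ‖x‖ ^ j` is turned into a bound for a multilinear form by polarization.
-/

/-! ### Polarization -/

/-- The polarization formula: the symmetrization of a `j`-linear form is determined by its values
on the diagonal. -/
theorem ContinuousMultilinearMap.sum_neg_one_pow_apply_sum {E : Type*} [NormedAddCommGroup E]
    [NormedSpace ℂ E] {j : ℕ} (B : ContinuousMultilinearMap ℂ (fun _ : Fin j => E) ℂ)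
    (v : Fin j → E) :
    ∑ T : Finset (Fin j), (-1 : ℂ) ^ T.card * B (fun _ => ∑ i ∈ Tᶜ, v i) =
      ∑ σ : Equiv.Perm (Fin j), B (fun i => v (σ i)) := by
  classical
  -- Expand `B (∑ v, …, ∑ v)` over maps `r`, exchange the sums, and cancel by inclusion-exclusion
  -- the contributions of all `r` that are not surjective.
  have h1 : ∀ T : Finset (Fin j), B (fun _ => ∑ i ∈ Tᶜ, v i) =
      ∑ r : Fin j → Fin j, if T ⊆ (Finset.univ.image r)ᶜ then B (fun i => v (r i)) else 0 := by
    intro T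
    rw [B.map_sum_finset (fun _ i => v i) (fun _ => Tᶜ), ← Finset.sum_filter]
    refine Finset.sum_congr ?_ fun _ _ => rfl
    ext r
    simp only [Fintype.mem_piFinset, Finset.mem_compl, Finset.mem_filter, Finset.mem_univ,
      true_and, Finset.subset_iff, Finset.mem_image, not_exists]
    exact ⟨fun h x hx i hi => h i (hi ▸ hx), fun h i hi => h hi i rfl⟩
  have h2 : ∀ r : Fin j → Fin j,
      (∑ T : Finset (Fin j), (-1 : ℂ) ^ T.card *
        if T ⊆ (Finset.univ.image r)ᶜ then B (fun i => v (r i)) else 0) =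
      if Function.Bijective r then B (fun i => v (r i)) else 0 := by
    intro r
    have h3 : (∑ T : Finset (Fin j), (-1 : ℂ) ^ T.card *
        if T ⊆ (Finset.univ.image r)ᶜ then B (fun i => v (r i)) else 0) =
        ((∑ T ∈ ((Finset.univ.image r)ᶜ).powerset, (-1 : ℤ) ^ T.card : ℤ) : ℂ) *
          B (fun i => v (r i)) := by
      push_cast
      rw [Finset.sum_mul]
      simp only [mul_ite, mul_zero]
      rw [← Finset.sum_filter]
      refine Finset.sum_congr ?_ fun _ _ => rfl
      ext T
      simp
    rw [h3, Finset.sum_powerset_neg_one_pow_card]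
    have h4 : (Finset.univ.image r)ᶜ = ∅ ↔ Function.Bijective r := by
      rw [Finset.compl_eq_empty_iff, ← Finite.surjective_iff_bijective,
        Finset.eq_univ_iff_forall]
      simp [Function.Surjective]
    simp only [h4]
    split_ifs <;> simp
  simp only [h1, Finset.mul_sum]
  rw [Finset.sum_comm]
  simp only [h2]
  rw [← Finset.sum_filter]
  symm
  refine Finset.sum_bij (fun σ _ => (σ : Fin j → Fin j)) ?_ ?_ ?_ ?_
  · intro σ _
    exact Finset.mem_filter.2 ⟨Finset.mem_univ _, σ.bijective⟩
  · intro σ _ τ _ h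
    exact Equiv.ext (congrFun h)
  · intro r hr
    exact ⟨Equiv.ofBijective r (Finset.mem_filter.1 hr).2, Finset.mem_univ _, rfl⟩
  · intro _ _
    rfl

/-- A homogeneous polynomial bounded by `c` on the unit ball comes from a multilinear form of norm
at most `c (2e) ^ j`, namely the symmetric one. -/
theorem exists_multilinear_norm_le {E : Type*} [NormedAddCommGroup E] [NormedSpace ℂ E] {j : ℕ}
    {P : E → ℂ} (hP : P ∈ homPoly E j) {c : ℝ} (hc0 : 0 ≤ c)
    (hc : ∀ x, ‖P x‖ ≤ c * ‖x‖ ^ j) :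
    ∃ B : ContinuousMultilinearMap ℂ (fun _ : Fin j => E) ℂ, (∀ x, P x = B fun _ => x) ∧
      ‖B‖ ≤ c * (2 * Real.exp 1) ^ j := by
  classical
  obtain ⟨B, hB⟩ := hP
  set S : ContinuousMultilinearMap ℂ (fun _ : Fin j => E) ℂ :=
    ((Nat.factorial j : ℕ) : ℂ)⁻¹ • ∑ σ : Equiv.Perm (Fin j), B.domDomCongr σ with hS
  have hj : ((Nat.factorial j : ℕ) : ℂ) ≠ 0 := by exact_mod_cast Nat.factorial_ne_zero j
  have hSa : ∀ v, S v = ((Nat.factorial j : ℕ) : ℂ)⁻¹ *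
      ∑ T : Finset (Fin j), (-1 : ℂ) ^ T.card * P (∑ i ∈ Tᶜ, v i) := by
    intro v
    simp only [hB]
    rw [B.sum_neg_one_pow_apply_sum v]
    simp [hS]
  refine ⟨S, fun x => ?_, ?_⟩
  · rw [hB]
    simp [hS, Fintype.card_perm, hj]
  have hunit : ∀ u : Fin j → E, (∀ i, ‖u i‖ ≤ 1) → ‖S u‖ ≤ c * (2 * Real.exp 1) ^ j := by
    intro u hu
    have h1 : ∀ T : Finset (Fin j), ‖(-1 : ℂ) ^ T.card * P (∑ i ∈ Tᶜ, u i)‖ ≤ c * (j : ℝ) ^ j := by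
      intro T
      rw [norm_mul, norm_pow, norm_neg, norm_one, one_pow, one_mul]
      refine (hc _).trans ?_
      gcongr
      calc ‖∑ i ∈ Tᶜ, u i‖ ≤ ∑ i ∈ Tᶜ, (1 : ℝ) := norm_sum_le_of_le _ fun i _ => hu i
        _ = (Tᶜ.card : ℝ) := by simp
        _ ≤ j := by exact_mod_cast (Finset.card_le_univ _).trans (by simp)
    rw [hSa, norm_mul, norm_inv, Complex.norm_natCast]
    -- There are `2 ^ j` subsets, and `j ^ j / j ! ≤ e ^ j`.
    have h2 := norm_sum_le_of_le Finset.univ fun T _ => h1 T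
    simp only [Finset.sum_const, Finset.card_univ, Fintype.card_finset, Fintype.card_fin,
      nsmul_eq_mul] at h2
    have h3 := Real.pow_div_factorial_le_exp (j : ℝ) (by positivity) j
    calc ((Nat.factorial j : ℕ) : ℝ)⁻¹ * _ ≤ ((Nat.factorial j : ℕ) : ℝ)⁻¹ *
          (((2 ^ j : ℕ) : ℝ) * (c * (j : ℝ) ^ j)) := by gcongr
      _ = c * 2 ^ j * ((j : ℝ) ^ j / (Nat.factorial j : ℕ)) := by push_cast; field_simp
      _ ≤ c * 2 ^ j * Real.exp j := by gcongr
      _ = c * (2 * Real.exp 1) ^ j := by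
        rw [mul_pow, ← Real.exp_nat_mul, mul_one, mul_assoc]
  refine ContinuousMultilinearMap.opNorm_le_bound (by positivity) fun v => ?_
  have hv : v = fun i => ((‖v i‖ : ℝ) : ℂ) • (((‖v i‖ : ℝ) : ℂ)⁻¹ • v i) := by
    funext i
    by_cases h : v i = 0
    · simp [h]
    · rw [smul_inv_smul₀]
      simpa using h
  rw [hv, ContinuousMultilinearMap.map_smul_univ, ← hv, norm_smul, mul_comm]
  refine mul_le_mul (hunit _ fun i => ?_) (by simp) (by positivity) (by positivity)
  rw [norm_smul, norm_inv, Complex.norm_real, norm_norm]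
  exact inv_mul_le_one

/-! ### Entire functions with given Taylor polynomials -/

section Taylor

variable {E : Type*} [NormedAddCommGroup E] [NormedSpace ℂ E]

theorem taylorPoly_of_hasFPowerSeriesOnBall {f : E → ℂ} {p : FormalMultilinearSeries ℂ E ℂ}
    {r : ℝ≥0∞} (h : HasFPowerSeriesOnBall f p 0 r) (j : ℕ) (x : E) :
    taylorPoly j f 0 x = p j fun _ => x := by
  have hj : ((Nat.factorial j : ℕ) : ℂ) ≠ 0 := by exact_mod_cast Nat.factorial_ne_zero j
  simp only [taylorPoly, polyDeriv, Pi.smul_apply, smul_eq_mul]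
  rw [← h.factorial_smul x j, nsmul_eq_mul, inv_mul_cancel_left₀ hj]

theorem polyDeriv_eq_factorial_smul (j : ℕ) (f : E → ℂ) (a : E) :
    polyDeriv j f a = ((Nat.factorial j : ℕ) : ℂ) • taylorPoly j f a := by
  have hj : ((Nat.factorial j : ℕ) : ℂ) ≠ 0 := by exact_mod_cast Nat.factorial_ne_zero j
  rw [taylorPoly, smul_inv_smul₀ hj]

theorem taylorPoly_zero_apply (f : E → ℂ) (a x : E) : taylorPoly 0 f a x = f a := by
  simp [taylorPoly, polyDeriv]

theorem eq_zero_of_taylorPoly_eq_zero {f : E → ℂ} (hf : AnalyticOnNhd ℂ f Set.univ)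
    (h : ∀ j, taylorPoly j f 0 = 0) : f = 0 := by
  obtain ⟨p, r, hp⟩ := hf 0 trivial
  refine hf.eq_of_eventuallyEq (z₀ := 0) (analyticOnNhd_const (v := 0)) ?_
  filter_upwards [hp.hasFPowerSeriesAt.eventually_hasSum] with x hx
  have h0 : ∀ n, (p n fun _ => x) = 0 := fun n => by
    rw [← taylorPoly_of_hasFPowerSeriesOnBall hp, h, Pi.zero_apply]
  simp only [h0, zero_add] at hx
  exact hx.unique hasSum_zero

/-- Homogeneous polynomials whose pointwise bounds decay faster than every geometric sequence are
the Taylor polynomials of an entire function. -/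
theorem exists_entire_taylorPoly_eq {P : ℕ → E → ℂ} (hP : ∀ j, P j ∈ homPoly E j) {c : ℕ → ℝ}
    (hc0 : ∀ j, 0 ≤ c j) (hc : ∀ j x, ‖P j x‖ ≤ c j * ‖x‖ ^ j)
    (hs : ∀ r : ℝ, 0 < r → Summable fun j => c j * r ^ j) :
    ∃ f : E → ℂ, AnalyticOnNhd ℂ f Set.univ ∧ (∀ j, taylorPoly j f 0 = P j) ∧
      ∀ x, f x = ∑' j, P j x := by
  choose B hB hBn using fun j => exists_multilinear_norm_le (hP j) (hc0 j) (hc j)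
  let p : FormalMultilinearSeries ℂ E ℂ := B
  have hr : p.radius = ⊤ := by
    refine FormalMultilinearSeries.radius_eq_top_of_summable_norm p fun r => ?_
    have h := hs (2 * Real.exp 1 * (r + 1)) (by positivity)
    refine Summable.of_nonneg_of_le (fun j => by positivity) (fun j => ?_) h
    calc ‖p j‖ * (r : ℝ) ^ j ≤ c j * (2 * Real.exp 1) ^ j * (r + 1) ^ j := by
          gcongr
          · have := hc0 j
            positivity
          · exact hBn j
          · simp
      _ = _ := by rw [mul_assoc, ← mul_pow]
  have hp : HasFPowerSeriesOnBall p.sum p 0 ⊤ := by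
    rw [← hr]
    exact p.hasFPowerSeriesOnBall (by simp [hr])
  refine ⟨p.sum, fun x _ => hp.analyticAt_of_mem (by simp), fun j => ?_, fun x => ?_⟩
  · funext x
    rw [taylorPoly_of_hasFPowerSeriesOnBall hp, hB]
  · simp only [FormalMultilinearSeries.sum, hB, p]

end Taylor

/-! ### Growth of the weights -/

theorem expWeight_zero (k : ℝ≥0∞) : expWeight k 0 = 1 := by
  simp [expWeight]

theorem expWeight_pos {k : ℝ≥0∞} (hk : 1 < k) (j : ℕ) : 0 < expWeight k j := by
  rcases Nat.eq_zero_or_pos j with rfl | hj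
  · rw [expWeight_zero]
    exact one_pos
  unfold expWeight
  split_ifs with h
  · exact one_pos
  · have hk0 : 0 < k.toReal := ENNReal.toReal_pos (zero_lt_one.trans hk).ne' h
    positivity

theorem eventually_one_le_expWeight {k : ℝ≥0∞} (hk : 1 < k) :
    ∀ᶠ j : ℕ in atTop, 1 ≤ expWeight k j := by
  by_cases h : k = ⊤
  · simp [expWeight, h]
  have hk0 : 0 < k.toReal := ENNReal.toReal_pos (zero_lt_one.trans hk).ne' h
  filter_upwards [tendsto_natCast_atTop_atTop.eventually_ge_atTop (k.toReal * Real.exp 1)]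
    with j hj
  rw [expWeight, if_neg h]
  exact Real.one_le_rpow ((one_le_div (by positivity)).2 hj) (by positivity)

/-- For finite `k` one can take `s = 1 - 1 / k`, for `k = ∞` one can take `s = 1`. -/
theorem exists_expWeight_le_rpow {k : ℝ≥0∞} (hk : 1 < k) :
    ∃ s : ℝ, 0 < s ∧ ∀ j, expWeight k j ≤ (Nat.factorial j : ℝ) ^ (1 - s) := by
  by_cases h : k = ⊤
  · exact ⟨1, one_pos, fun j => by simp [expWeight, h]⟩
  have hk1 : 1 < k.toReal := by
    simpa using (ENNReal.toReal_lt_toReal ENNReal.one_ne_top h).2 hk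
  have hk0 : 0 < k.toReal := one_pos.trans hk1
  refine ⟨1 - 1 / k.toReal, by rw [sub_pos, div_lt_one hk0]; exact hk1, fun j => ?_⟩
  rw [expWeight, if_neg h, sub_sub_cancel, div_eq_mul_one_div (j : ℝ) k.toReal,
    Real.rpow_mul (by positivity), Real.rpow_natCast]
  refine Real.rpow_le_rpow (by positivity) ?_ (by positivity)
  have h3 := Real.pow_div_factorial_le_exp (j : ℝ) (by positivity) j
  rw [div_le_iff₀ (by positivity)] at h3
  calc ((j : ℝ) / (k.toReal * Real.exp 1)) ^ j ≤ ((j : ℝ) / (1 * Real.exp 1)) ^ j := by gcongr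
    _ = (j : ℝ) ^ j / Real.exp j := by
      rw [one_mul, div_pow, ← Real.exp_nat_mul, mul_one]
    _ ≤ (Nat.factorial j : ℝ) := by
      rw [div_le_iff₀ (Real.exp_pos _), mul_comm]
      exact h3

theorem summable_expWeight_div_factorial {k : ℝ≥0∞} (hk : 1 < k) {r : ℝ} (hr : 0 ≤ r) :
    Summable fun j : ℕ => expWeight k j / (Nat.factorial j : ℝ) * r ^ j := by
  obtain ⟨s, hs, hw⟩ := exists_expWeight_le_rpow hk
  -- With `x ^ s = 2 r`, the bound `x ^ j ≤ j !` for large `j` leaves a factor `2 ^ (-j)`.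
  set x : ℝ := (2 * r) ^ (1 / s) with hx
  have hx0 : 0 ≤ x := by positivity
  have hlim := FloorSemiring.tendsto_pow_div_factorial_atTop x
  refine Summable.of_norm_bounded_eventually_nat (g := fun j : ℕ => ((1 : ℝ) / 2) ^ j)
    (summable_geometric_of_lt_one (by norm_num) (by norm_num)) ?_
  filter_upwards [hlim.eventually_lt_const one_pos] with j hj
  have hf : (0 : ℝ) < Nat.factorial j := by positivity
  have h1 : x ^ j ≤ Nat.factorial j := ((div_lt_one hf).1 hj).le
  have h2 : (2 * r) ^ j ≤ (Nat.factorial j : ℝ) ^ s := by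
    have := Real.rpow_le_rpow (by positivity) h1 hs.le
    rwa [← Real.rpow_natCast, ← Real.rpow_mul hx0, mul_comm (j : ℝ), Real.rpow_mul hx0, hx,
      ← Real.rpow_mul (by positivity) (1 / s) s, one_div_mul_cancel hs.ne', Real.rpow_one,
      Real.rpow_natCast] at this
  rw [Real.norm_of_nonneg (mul_nonneg (div_nonneg (expWeight_nonneg k j) hf.le) (by positivity))]
  calc expWeight k j / (Nat.factorial j : ℝ) * r ^ j
      ≤ (Nat.factorial j : ℝ) ^ (1 - s) / (Nat.factorial j : ℝ) * r ^ j := by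
        gcongr
        exact hw j
    _ = ((Nat.factorial j : ℝ) ^ s)⁻¹ * r ^ j := by
        rw [Real.rpow_sub hf, Real.rpow_one]
        field_simp
    _ = ((Nat.factorial j : ℝ) ^ s)⁻¹ * (2 * r) ^ j * (1 / 2) ^ j := by
        rw [mul_assoc, ← mul_pow]
        congr 2
        ring
    _ ≤ ((Nat.factorial j : ℝ) ^ s)⁻¹ * (Nat.factorial j : ℝ) ^ s * (1 / 2) ^ j := by gcongr
    _ = (1 / 2) ^ j := by
        rw [inv_mul_cancel₀ (by positivity), one_mul]

/-! ### Elements of the spaces `Exp^k_{Θ,0}(E)` -/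

section ExpSpaceBasic

variable {E : Type*} [NormedAddCommGroup E] [NormedSpace ℂ E]

theorem HolomorphyType.norm_neg (Θ : HolomorphyType E) {j : ℕ} {P : E → ℂ}
    (hP : P ∈ Θ.space j) : Θ.thetaNorm j (-P) = Θ.thetaNorm j P := by
  simpa using Θ.norm_smul j (-1) P hP

theorem HolomorphyType.norm_sub_le (Θ : HolomorphyType E) {j : ℕ} {P Q : E → ℂ}
    (hP : P ∈ Θ.space j) (hQ : Q ∈ Θ.space j) :
    Θ.thetaNorm j (P - Q) ≤ Θ.thetaNorm j P + Θ.thetaNorm j Q := by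
  rw [sub_eq_add_neg, ← Θ.norm_neg hQ]
  exact Θ.norm_add_le j P hP (-Q) (Submodule.neg_mem _ hQ)

/-- The inclusion of `P_Θ(^j E)` into `P(^j E)` has norm at most `σ ^ j`: this is the bound on
derivatives for the derivative of order `0`. -/
theorem HolomorphyType.norm_apply_le (Θ : HolomorphyType E) :
    ∃ σ : ℝ, 1 ≤ σ ∧ ∀ (j : ℕ), ∀ P ∈ Θ.space j, ∀ a : E,
      ‖P a‖ ≤ σ ^ j * Θ.thetaNorm j P * ‖a‖ ^ j := by
  obtain ⟨σ, hσ, h⟩ := Θ.deriv_bound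
  refine ⟨σ, hσ, fun j P hP a => ?_⟩
  have h1 := (h 0 j (Nat.zero_le j) a P hP).2
  have h2 : taylorPoly 0 P a = fun _ => P a := funext fun x => taylorPoly_zero_apply P a x
  rwa [h2, Θ.norm_const, Nat.sub_zero] at h1

variable {Θ : HolomorphyType E} {k : ℝ≥0∞}

namespace ExpSpace

theorem analytic (f : ExpSpace Θ k) : AnalyticOnNhd ℂ f.toFun Set.univ := f.memExp.1

theorem taylor_mem (f : ExpSpace Θ k) (j : ℕ) : taylorPoly j f 0 ∈ Θ.space j :=
  taylorPoly_mem Θ (f.memExp.2.1 j)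

theorem summable_expTerm (f : ExpSpace Θ k) {ρ : ℝ} (hρ : 0 < ρ) : Summable (expTerm Θ k ρ f) :=
  ((memExp_iff Θ k f).1 f.memExp).2.2 ρ hρ

theorem expTerm_nonneg' (f : ExpSpace Θ k) {ρ : ℝ} (hρ : 0 < ρ) (j : ℕ) :
    0 ≤ expTerm Θ k ρ f j := expTerm_nonneg Θ k hρ (f.memExp.2.1 j)

theorem expTerm_le_expNorm (f : ExpSpace Θ k) {ρ : ℝ} (hρ : 0 < ρ) (j : ℕ) :
    expTerm Θ k ρ f j ≤ expNorm Θ k ρ f :=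
  (f.summable_expTerm hρ).le_tsum j fun i _ => f.expTerm_nonneg' hρ i

theorem expNorm_antitone (f : ExpSpace Θ k) {ρ ρ' : ℝ} (hρ : 0 < ρ) (h : ρ ≤ ρ') :
    expNorm Θ k ρ' f ≤ expNorm Θ k ρ f := by
  refine (f.summable_expTerm (hρ.trans_le h)).tsum_le_tsum (fun j => ?_) (f.summable_expTerm hρ)
  unfold expTerm
  have := expWeight_nonneg k j
  have := Θ.norm_nonneg (f.taylor_mem j)
  gcongr

theorem toFun_injective : Function.Injective (toFun : ExpSpace Θ k → E → ℂ) :=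
  fun _ _ h => Subtype.ext h

theorem toFun_add (f g : ExpSpace Θ k) : (f + g).toFun = f.toFun + g.toFun := rfl

theorem toFun_smul (c : ℂ) (f : ExpSpace Θ k) : (c • f).toFun = c • f.toFun := rfl

theorem taylor_add (f g : ExpSpace Θ k) (j : ℕ) :
    taylorPoly j (f + g : ExpSpace Θ k) 0 = taylorPoly j f 0 + taylorPoly j g 0 := by
  simp only [toFun_add, taylorPoly, polyDeriv_add f.analytic g.analytic, smul_add]

theorem taylor_smul (c : ℂ) (f : ExpSpace Θ k) (j : ℕ) :
    taylorPoly j (c • f : ExpSpace Θ k) 0 = c • taylorPoly j f 0 := by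
  simp only [toFun_smul, taylorPoly, polyDeriv_smul f.analytic, smul_comm c]

/-- The map sending `f` to its `j`-th Taylor polynomial at `0`. -/
noncomputable def taylor (Θ : HolomorphyType E) (k : ℝ≥0∞) (j : ℕ) :
    ExpSpace Θ k →ₗ[ℂ] E → ℂ where
  toFun f := taylorPoly j f 0
  map_add' f g := taylor_add f g j
  map_smul' c f := taylor_smul c f j

theorem taylor_apply (f : ExpSpace Θ k) (j : ℕ) : taylor Θ k j f = taylorPoly j f 0 := rfl

theorem taylor_sub (f g : ExpSpace Θ k) (j : ℕ) :
    taylorPoly j (f - g : ExpSpace Θ k) 0 = taylorPoly j f 0 - taylorPoly j g 0 :=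
  map_sub (taylor Θ k j) f g

theorem ext_taylor {f g : ExpSpace Θ k} (h : ∀ j, taylorPoly j f 0 = taylorPoly j g 0) :
    f = g := by
  rw [← sub_eq_zero]
  refine toFun_injective (eq_zero_of_taylorPoly_eq_zero (f - g).analytic fun j => ?_)
  rw [taylor_sub, h, sub_self]

/-- An element of `Exp^k_{Θ,0}(E)` can be prescribed through its Taylor polynomials. -/
theorem exists_taylorPoly_eq (hk : 1 < k) {P : ℕ → E → ℂ} (hP : ∀ j, P j ∈ Θ.space j)
    (hs : ∀ ρ : ℝ, 0 < ρ → Summable fun j => (ρ ^ j)⁻¹ * expWeight k j * Θ.thetaNorm j (P j)) :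
    ∃ f : ExpSpace Θ k, (∀ j, taylorPoly j f 0 = P j) ∧ ∀ x, f x = ∑' j, P j x := by
  obtain ⟨σ, hσ, hb⟩ := Θ.norm_apply_le
  have hn : ∀ j, 0 ≤ Θ.thetaNorm j (P j) := fun j => Θ.norm_nonneg (hP j)
  obtain ⟨f, hfa, hft, hfx⟩ := exists_entire_taylorPoly_eq (fun j => Θ.space_le j (hP j))
    (c := fun j => σ ^ j * Θ.thetaNorm j (P j))
    (fun j => mul_nonneg (by positivity) (hn j)) (fun j x => hb j _ (hP j) x) (fun r hr => by
      -- The weights are eventually at least `1` and can be dropped.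
      refine Summable.of_norm_bounded_eventually_nat (hs (σ * r)⁻¹ (by positivity)) ?_
      filter_upwards [eventually_one_le_expWeight hk] with j hj
      have := hn j
      rw [Real.norm_of_nonneg (by positivity), inv_pow, inv_inv, mul_pow]
      calc σ ^ j * Θ.thetaNorm j (P j) * r ^ j
          = σ ^ j * r ^ j * 1 * Θ.thetaNorm j (P j) := by ring
        _ ≤ _ := by gcongr)
  have hmem : MemExp Θ k f := by
    refine (memExp_iff Θ k f).2 ⟨hfa, fun j => ?_, fun ρ hρ => ?_⟩
    · rw [polyDeriv_eq_factorial_smul, hft]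
      exact Submodule.smul_mem _ _ (hP j)
    · refine (hs ρ hρ).congr fun j => ?_
      rw [expTerm, hft]
  exact ⟨(⟨f, hmem⟩ : expSubmodule Θ k), hft, hfx⟩

theorem exists_single (hk : 1 < k) {j : ℕ} {P : E → ℂ} (hP : P ∈ Θ.space j) :
    ∃ f : ExpSpace Θ k, ∀ i, taylorPoly i f 0 = if i = j then P else 0 := by
  obtain ⟨f, hf, -⟩ := exists_taylorPoly_eq (Θ := Θ) hk (P := fun i => if i = j then P else 0)
    (fun i => by
      split_ifs with h
      · exact h ▸ hP
      · exact Submodule.zero_mem _)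
    (fun ρ _ => summable_of_ne_finset_zero (s := {j}) fun i hi => by
      rw [if_neg (by simpa using hi), Θ.norm_zero, mul_zero])
  exact ⟨f, hf⟩

/-- The inclusion of `P_Θ(^j E)` into `Exp^k_{Θ,0}(E)`, characterized by the Taylor polynomials of
its values. -/
noncomputable def single (hk : 1 < k) (j : ℕ) : Θ.space j →ₗ[ℂ] ExpSpace Θ k where
  toFun P := (exists_single hk P.2).choose
  map_add' P Q := ext_taylor fun i => by
    rw [taylor_add, (exists_single hk (P + Q).2).choose_spec, (exists_single hk P.2).choose_spec,
      (exists_single hk Q.2).choose_spec]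
    split_ifs <;> simp
  map_smul' c P := ext_taylor fun i => by
    rw [RingHom.id_apply, taylor_smul, (exists_single hk (c • P).2).choose_spec,
      (exists_single hk P.2).choose_spec]
    split_ifs <;> simp

theorem taylor_single (hk : 1 < k) {j : ℕ} (P : Θ.space j) (i : ℕ) :
    taylorPoly i (single hk j P) 0 = if i = j then (P : E → ℂ) else 0 :=
  (exists_single hk P.2).choose_spec i

theorem expNorm_single (hk : 1 < k) {j : ℕ} (P : Θ.space j) (ρ : ℝ) :
    expNorm Θ k ρ (single hk j P) = (ρ ^ j)⁻¹ * expWeight k j * Θ.thetaNorm j P := by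
  rw [expNorm, tsum_eq_single j]
  · rw [expTerm, taylor_single, if_pos rfl]
  · intro i hi
    rw [expTerm, taylor_single, if_neg hi, Θ.norm_zero, mul_zero]

/-! ### The topology of `Exp^k_{Θ,0}(E)` -/

instance : IsTopologicalAddGroup (ExpSpace Θ k) :=
  (withSeminorms_expSeminorm Θ k).topologicalAddGroup

instance : ContinuousSMul ℂ (ExpSpace Θ k) :=
  (withSeminorms_expSeminorm Θ k).continuousSMul

instance : LocallyConvexSpace ℝ (ExpSpace Θ k) :=
  (withSeminorms_expSeminorm Θ k).toLocallyConvexSpace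

theorem expSeminorm_apply (ρ : {ρ : ℝ // 0 < ρ}) (f : ExpSpace Θ k) :
    expSeminorm Θ k ρ f = expNorm Θ k ρ f := rfl

theorem expNorm_nonneg (f : ExpSpace Θ k) {ρ : ℝ} (hρ : 0 < ρ) : 0 ≤ expNorm Θ k ρ f :=
  tsum_nonneg fun j => f.expTerm_nonneg' hρ j

theorem exists_sup_expSeminorm_le (s : Finset {ρ : ℝ // 0 < ρ}) :
    ∃ ρ : {ρ : ℝ // 0 < ρ}, s.sup (expSeminorm Θ k) ≤ expSeminorm Θ k ρ := by
  have : Nonempty {ρ : ℝ // 0 < ρ} := ⟨⟨1, one_pos⟩⟩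
  obtain ⟨ρ, hρ⟩ : ∃ ρ, ∀ i ∈ s, ρ ≤ i :=
    Finset.exists_le (α := {ρ : ℝ // 0 < ρ}ᵒᵈ) s
  exact ⟨ρ, Finset.sup_le fun i hi f => expNorm_antitone f ρ.2 (hρ i hi)⟩

/-- The norms decrease in `ρ`, so that a single parameter serves for both norm and radius. -/
theorem hasBasis_nhds_zero :
    (𝓝 (0 : ExpSpace Θ k)).HasBasis (fun ε : ℝ => 0 < ε)
      fun ε => {f : ExpSpace Θ k | expNorm Θ k ε f < ε} := by
  refine (withSeminorms_expSeminorm Θ k).hasBasis_zero_ball.to_hasBasis ?_ ?_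
  · rintro ⟨s, r⟩ hr
    obtain ⟨ρ, hρ⟩ := exists_sup_expSeminorm_le (Θ := Θ) (k := k) s
    refine ⟨min (ρ : ℝ) r, lt_min ρ.2 hr, fun f hf => ?_⟩
    rw [Seminorm.mem_ball_zero]
    calc s.sup (expSeminorm Θ k) f ≤ expNorm Θ k ρ f := hρ f
      _ ≤ expNorm Θ k (min (ρ : ℝ) r) f := expNorm_antitone f (lt_min ρ.2 hr) (min_le_left _ _)
      _ < min (ρ : ℝ) r := hf
      _ ≤ r := min_le_right _ _
  · intro ε hε
    refine ⟨({⟨ε, hε⟩}, ε), hε, fun f hf => ?_⟩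
    rw [Finset.sup_singleton, Seminorm.mem_ball_zero] at hf
    exact hf

theorem tendsto_iff {ι : Type*} {l : Filter ι} {u : ι → ExpSpace Θ k} {f : ExpSpace Θ k} :
    Tendsto u l (𝓝 f) ↔
      ∀ ρ : ℝ, 0 < ρ → Tendsto (fun i => expNorm Θ k ρ (u i - f : ExpSpace Θ k)) l (𝓝 0) := by
  rw [(withSeminorms_expSeminorm Θ k).tendsto_nhds]
  constructor
  · intro h ρ hρ
    rw [Metric.tendsto_nhds]
    intro ε hε
    filter_upwards [h ⟨ρ, hρ⟩ ε hε] with i hi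
    rw [dist_zero_right, Real.norm_of_nonneg (expNorm_nonneg _ hρ)]
    exact hi
  · intro h ρ ε hε
    exact (h ρ ρ.2).eventually_lt_const hε

theorem t2Space (hk : 1 < k) : T2Space (ExpSpace Θ k) := by
  have : T1Space (ExpSpace Θ k) :=
    (withSeminorms_expSeminorm Θ k).T1_of_separating fun f hf => by
      obtain ⟨j, hj⟩ : ∃ j, taylorPoly j f 0 ≠ 0 := by
        by_contra h
        push Not at h
        exact hf (toFun_injective (eq_zero_of_taylorPoly_eq_zero f.analytic h))
      refine ⟨⟨1, one_pos⟩, fun h0 => ?_⟩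
      have h1 := f.expTerm_le_expNorm one_pos j
      rw [expSeminorm_apply] at h0
      rw [h0] at h1
      have h2 := le_antisymm h1 (f.expTerm_nonneg' one_pos j)
      rw [expTerm, one_pow, inv_one, one_mul] at h2
      rcases mul_eq_zero.1 h2 with h3 | h3
      · exact (expWeight_pos hk j).ne' h3
      · exact hj (Θ.eq_zero_of_norm j _ (f.taylor_mem j) h3)
  infer_instance

theorem exists_norm_le_expNorm (T : ExpSpace Θ k →L[ℂ] ℂ) :
    ∃ ρ : ℝ, 0 < ρ ∧ ∃ C : ℝ, 0 ≤ C ∧ ∀ f : ExpSpace Θ k, ‖T f‖ ≤ C * expNorm Θ k ρ f := by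
  obtain ⟨s, C, -, hC⟩ := Seminorm.bound_of_continuous (withSeminorms_expSeminorm Θ k)
    ((normSeminorm ℂ ℂ).comp T.toLinearMap) (continuous_norm.comp T.continuous)
  obtain ⟨ρ, hρ⟩ := exists_sup_expSeminorm_le (Θ := Θ) (k := k) s
  refine ⟨ρ, ρ.2, C, C.2, fun f => (hC f).trans ?_⟩
  exact mul_le_mul_of_nonneg_left (hρ f) C.2

/-- Evaluation at `0`, which is continuous because `|f(0)|` is the term of index `0` in every
`‖f‖_{Θ, k, ρ}`. -/
noncomputable def evalZero (Θ : HolomorphyType E) (k : ℝ≥0∞) : ExpSpace Θ k →L[ℂ] ℂ where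
  toFun f := f 0
  map_add' _ _ := rfl
  map_smul' _ _ := rfl
  cont := by
    let T : ExpSpace Θ k →ₗ[ℂ] ℂ := ⟨⟨fun f => f 0, fun _ _ => rfl⟩, fun _ _ => rfl⟩
    refine WithSeminorms.continuous_normedSpace_rng ℂ (withSeminorms_expSeminorm Θ k) T
      ⟨{⟨1, one_pos⟩}, 1, fun f => ?_⟩
    rw [Finset.sup_singleton, one_smul]
    have h1 := f.expTerm_le_expNorm one_pos 0
    have h2 : taylorPoly 0 f 0 = fun _ => f 0 :=
      funext fun x => taylorPoly_zero_apply f 0 x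
    rw [expTerm, h2, Θ.norm_const, expWeight_zero] at h1
    rw [pow_zero, inv_one, one_mul, one_mul] at h1
    exact h1

/-- The Taylor series of `f` at `0` converges to `f` in `Exp^k_{Θ,0}(E)`. -/
theorem hasSum_single (hk : 1 < k) (f : ExpSpace Θ k) :
    HasSum (fun j => single hk j ⟨taylorPoly j f 0, f.taylor_mem j⟩) f := by
  rw [HasSum, SummationFilter.unconditional_filter, tendsto_iff]
  intro ρ hρ
  have h1 : ∀ (s : Finset ℕ) (i : ℕ),
      taylorPoly i (∑ j ∈ s, single hk j ⟨taylorPoly j f 0, f.taylor_mem j⟩ - f :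
        ExpSpace Θ k) 0 = if i ∈ s then 0 else - taylorPoly i f 0 := by
    intro s i
    rw [taylor_sub, ← taylor_apply (∑ j ∈ s, _), map_sum]
    simp only [taylor_apply, taylor_single, Finset.sum_ite_eq]
    split_ifs <;> simp
  have h2 : ∀ s : Finset ℕ, expNorm Θ k ρ
      (∑ j ∈ s, single hk j ⟨taylorPoly j f 0, f.taylor_mem j⟩ - f : ExpSpace Θ k) =
        ∑' j : {j // j ∉ s}, expTerm Θ k ρ f j := by
    intro s
    rw [expNorm, ← tsum_subtype_eq_of_support_subset (s := {j | j ∉ s})]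
    · refine tsum_congr fun j => ?_
      have hj : (j : ℕ) ∉ s := j.2
      rw [expTerm, h1, if_neg hj, Θ.norm_neg (f.taylor_mem j), expTerm]
    · intro j hj
      by_contra hjs
      rw [Set.mem_ofPred_eq, not_not] at hjs
      exact hj (by rw [expTerm, h1, if_pos hjs, Θ.norm_zero, mul_zero])
  simp only [h2]
  exact tendsto_tsum_compl_atTop_zero _

end ExpSpace
end ExpSpaceBasic

/-! ### Completeness -/

section Complete

variable {E : Type*} [NormedAddCommGroup E] [NormedSpace ℂ E]
variable {Θ : HolomorphyType E} {k : ℝ≥0∞}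

namespace ExpSpace

theorem exists_tendsto_of_cauchy (hk : 1 < k) {u : ℕ → ExpSpace Θ k}
    (hu : ∀ ε : ℝ, 0 < ε → ∃ N, ∀ m ≥ N, ∀ n ≥ N, expNorm Θ k ε (u m - u n : ExpSpace Θ k) < ε) :
    ∃ f, Tendsto u atTop (𝓝 f) := by
  have hw := expWeight_pos hk
  have hθ : ∀ j, ∃ P ∈ Θ.space j,
      Tendsto (fun n => Θ.thetaNorm j (taylorPoly j (u n) 0 - P)) atTop (𝓝 0) := by
    intro j
    refine Θ.complete j _ (fun n => (u n).taylor_mem j) fun δ hδ => ?_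
    have hε : 0 < min 1 (expWeight k j * δ) := lt_min one_pos (mul_pos (hw j) hδ)
    obtain ⟨N, hN⟩ := hu _ hε
    refine ⟨N, fun m hm n hn => ?_⟩
    have h1 := ((u m - u n).expTerm_le_expNorm hε j).trans_lt (hN m hm n hn)
    rw [expTerm, taylor_sub] at h1
    have h0 := Θ.norm_nonneg (Submodule.sub_mem _ ((u m).taylor_mem j) ((u n).taylor_mem j))
    have h2 : 1 ≤ ((min 1 (expWeight k j * δ)) ^ j)⁻¹ :=
      (one_le_inv₀ (by positivity)).2 (pow_le_one₀ hε.le (min_le_left _ _))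
    have h3 : expWeight k j * Θ.thetaNorm j (taylorPoly j (u m) 0 - taylorPoly j (u n) 0) <
        expWeight k j * δ := by
      refine lt_of_le_of_lt ?_ (h1.trans_le (min_le_right _ _))
      rw [mul_assoc]
      exact le_mul_of_one_le_left (mul_nonneg (hw j).le h0) h2
    exact lt_of_mul_lt_mul_left h3 (hw j).le
  choose P hP hPt using hθ
  -- The Cauchy condition passes to the coefficientwise limit on finite partial sums.
  have hdiff : ∀ n j, taylorPoly j (u n) 0 - P j ∈ Θ.space j := fun n j =>
    Submodule.sub_mem _ ((u n).taylor_mem j) (hP j)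
  have hnn : ∀ ρ : ℝ, 0 < ρ → ∀ n j,
      0 ≤ (ρ ^ j)⁻¹ * expWeight k j * Θ.thetaNorm j (taylorPoly j (u n) 0 - P j) :=
    fun ρ hρ n j => mul_nonneg (mul_nonneg (by positivity) (hw j).le) (Θ.norm_nonneg (hdiff n j))
  have key : ∀ ρ : ℝ, 0 < ρ → ∀ ε : ℝ, 0 < ε → ∃ N, ∀ n ≥ N, ∀ s : Finset ℕ,
      ∑ j ∈ s, (ρ ^ j)⁻¹ * expWeight k j * Θ.thetaNorm j (taylorPoly j (u n) 0 - P j) ≤ ε := by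
    intro ρ hρ ε hε
    obtain ⟨N, hN⟩ := hu (min ρ ε) (lt_min hρ hε)
    refine ⟨N, fun n hn s => ?_⟩
    have hlim : Tendsto (fun m => ε + ∑ j ∈ s, (ρ ^ j)⁻¹ * expWeight k j *
        Θ.thetaNorm j (taylorPoly j (u m) 0 - P j)) atTop (𝓝 ε) := by
      have := tendsto_const_nhds (x := ε) |>.add (tendsto_finsetSum s fun j _ =>
        (hPt j).const_mul ((ρ ^ j)⁻¹ * expWeight k j))
      simpa using this
    refine ge_of_tendsto hlim ?_
    filter_upwards [eventually_ge_atTop N] with m hm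
    have h1 : ∑ j ∈ s, expTerm Θ k ρ (u n - u m : ExpSpace Θ k) j ≤ ε :=
      calc _ ≤ expNorm Θ k ρ (u n - u m : ExpSpace Θ k) :=
            ((u n - u m).summable_expTerm hρ).sum_le_tsum s
              fun j _ => (u n - u m).expTerm_nonneg' hρ j
        _ ≤ expNorm Θ k (min ρ ε) (u n - u m : ExpSpace Θ k) :=
            expNorm_antitone _ (lt_min hρ hε) (min_le_left _ _)
        _ ≤ min ρ ε := (hN n hn m hm).le
        _ ≤ ε := min_le_right _ _
    refine le_trans ?_ (add_le_add_left h1 _)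
    rw [← Finset.sum_add_distrib]
    refine Finset.sum_le_sum fun j _ => ?_
    rw [expTerm, taylor_sub, ← mul_add]
    refine mul_le_mul_of_nonneg_left ?_ (mul_nonneg (by positivity) (hw j).le)
    have h2 := Θ.norm_add_le j (taylorPoly j (u n) 0 - taylorPoly j (u m) 0)
      (Submodule.sub_mem _ ((u n).taylor_mem j) ((u m).taylor_mem j)) _ (hdiff m j)
    rwa [sub_add_sub_cancel] at h2
  obtain ⟨f, hf, -⟩ := exists_taylorPoly_eq hk hP fun ρ hρ => by
    obtain ⟨N, hN⟩ := key ρ hρ 1 one_pos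
    have h1 := summable_of_sum_le (hnn ρ hρ N) (hN N le_rfl)
    refine Summable.of_nonneg_of_le (fun j => mul_nonneg (mul_nonneg (by positivity) (hw j).le)
      (Θ.norm_nonneg (hP j))) (fun j => ?_) (((u N).summable_expTerm hρ).add h1)
    rw [expTerm, ← mul_add]
    refine mul_le_mul_of_nonneg_left ?_ (mul_nonneg (by positivity) (hw j).le)
    have h2 := Θ.norm_sub_le ((u N).taylor_mem j) (hdiff N j)
    rwa [sub_sub_cancel] at h2
  refine ⟨f, tendsto_iff.2 fun ρ hρ => ?_⟩
  rw [Metric.tendsto_atTop]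
  intro ε hε
  obtain ⟨N, hN⟩ := key ρ hρ (ε / 2) (half_pos hε)
  refine ⟨N, fun n hn => ?_⟩
  rw [dist_zero_right, Real.norm_of_nonneg (expNorm_nonneg _ hρ)]
  refine lt_of_le_of_lt ?_ (half_lt_self hε)
  refine ((u n - f).summable_expTerm hρ).tsum_le_of_sum_le fun s => ?_
  simpa only [expTerm, taylor_sub, hf] using hN n hn s

theorem isCountablyGenerated_nhds_zero : (𝓝 (0 : ExpSpace Θ k)).IsCountablyGenerated := by
  refine (hasBasis_nhds_zero (Θ := Θ) (k := k)).to_hasBasis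
    (p' := fun _ : ℕ => True) (s' := fun n : ℕ => {f : ExpSpace Θ k |
      expNorm Θ k (1 / (n + 1 : ℝ)) f < 1 / (n + 1 : ℝ)}) ?_ ?_ |>.isCountablyGenerated
  · intro ε hε
    obtain ⟨n, hn⟩ := exists_nat_one_div_lt hε
    refine ⟨n, trivial, fun f hf => ?_⟩
    exact ((expNorm_antitone f Nat.one_div_pos_of_nat hn.le).trans_lt hf).trans hn
  · intro n _
    exact ⟨_, Nat.one_div_pos_of_nat, subset_rfl⟩

theorem isCompletelyPseudoMetrizableSpace (hk : 1 < k) :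
    TopologicalSpace.IsCompletelyPseudoMetrizableSpace (ExpSpace Θ k) := by
  let _ : UniformSpace (ExpSpace Θ k) := IsTopologicalAddGroup.rightUniformSpace _
  have : IsUniformAddGroup (ExpSpace Θ k) := isUniformAddGroup_of_addCommGroup
  have := isCountablyGenerated_nhds_zero (Θ := Θ) (k := k)
  have : (uniformity (ExpSpace Θ k)).IsCountablyGenerated :=
    IsUniformAddGroup.uniformity_countably_generated
  have : CompleteSpace (ExpSpace Θ k) := by
    refine UniformSpace.complete_of_cauchySeq_tendsto fun u hu => exists_tendsto_of_cauchy hk ?_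
    intro ε hε
    rw [cauchySeq_iff] at hu
    have hV : {p : ExpSpace Θ k × ExpSpace Θ k | expNorm Θ k ε (p.1 - p.2 : ExpSpace Θ k) < ε} ∈
        uniformity (ExpSpace Θ k) := by
      rw [uniformity_eq_comap_nhds_zero_swapped]
      exact preimage_mem_comap (hasBasis_nhds_zero.mem_of_mem hε)
    obtain ⟨N, hN⟩ := hu _ hV
    exact ⟨N, fun m hm n hn => hN m hm n hn⟩
  let _ := UniformSpace.pseudoMetricSpace (ExpSpace Θ k)
  infer_instance

end ExpSpace
end Complete

/-! ### Exponentials -/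

section Exponential

variable {E : Type*} [NormedAddCommGroup E] [NormedSpace ℂ E]
variable {Θ : HolomorphyType E} {k : ℝ≥0∞}

namespace HolomorphyType.IsPiOne

theorem pow_mem (hΘ : Θ.IsPiOne) (j : ℕ) (φ : StrongDual ℂ E) :
    (fun x => φ x ^ j) ∈ Θ.space j :=
  hΘ.1 j (Submodule.subset_span ⟨φ, 1, by simp⟩)

/-- The polynomial `φ ^ j` as an element of `P_Θ(^j E)`. -/
noncomputable def pow (hΘ : Θ.IsPiOne) (j : ℕ) (φ : StrongDual ℂ E) : Θ.space j :=
  ⟨fun x => φ x ^ j, hΘ.pow_mem j φ⟩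

theorem exists_thetaNorm_pow_le (hΘ : Θ.IsPiOne) : ∃ K : ℝ, 0 < K ∧
    ∀ (j : ℕ) (φ : StrongDual ℂ E), Θ.thetaNorm j (hΘ.pow j φ) ≤ (K * ‖φ‖) ^ j := by
  obtain ⟨K, hK, h⟩ := hΘ.2.1
  refine ⟨K, hK, fun j φ => ?_⟩
  simpa [pow, mul_pow] using h j φ 1

theorem pow_smul (hΘ : Θ.IsPiOne) (j : ℕ) (z : ℂ) (φ : StrongDual ℂ E) :
    hΘ.pow j (z • φ) = z ^ j • hΘ.pow j φ := by
  ext x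
  simp [pow, mul_pow]

/-- Lagrange interpolation in `z` at the nodes `0, …, j`: along a complex line, `φ ↦ φ ^ j` is a
polynomial map with values in a finite-dimensional subspace of `P_Θ(^j E)`. -/
theorem pow_add_smul_eq_sum (hΘ : Θ.IsPiOne) (j : ℕ) (φ ψ : StrongDual ℂ E) (z : ℂ) :
    hΘ.pow j (φ + z • ψ) = ∑ i ∈ Finset.range (j + 1),
      (Lagrange.basis (Finset.range (j + 1)) (fun i : ℕ => (i : ℂ)) i).eval z •
        hΘ.pow j (φ + (i : ℂ) • ψ) := by
  ext x
  let p : Polynomial ℂ := (Polynomial.C (φ x) + Polynomial.C (ψ x) * Polynomial.X) ^ j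
  have hp : ∀ w : ℂ, p.eval w = (φ x + w * ψ x) ^ j := fun w => by
    simp only [p, Polynomial.eval_pow, Polynomial.eval_add, Polynomial.eval_mul, Polynomial.eval_C,
      Polynomial.eval_X, mul_comm]
  have hdeg : p.degree < (Finset.range (j + 1)).card := by
    rw [Finset.card_range]
    refine lt_of_le_of_lt (Polynomial.degree_le_of_natDegree_le (n := j) ?_)
      (by exact_mod_cast Nat.lt_succ_self j)
    refine Polynomial.natDegree_pow_le_of_le j (m := 1) ?_ |>.trans (by simp)
    compute_degree
  have h := congrArg (Polynomial.eval z) (Lagrange.eq_interpolate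
    (v := fun i : ℕ => (i : ℂ)) (fun a _ b _ hab => Nat.cast_injective hab) hdeg)
  rw [Lagrange.interpolate_apply, Polynomial.eval_finsetSum, hp] at h
  simp only [Polynomial.eval_mul, Polynomial.eval_C, hp] at h
  simp only [pow, add_apply, smul_apply, smul_eq_mul, Submodule.coe_sum,
    Submodule.coe_smul, Finset.sum_apply, Pi.smul_apply]
  rw [h]
  exact Finset.sum_congr rfl fun i _ => mul_comm _ _

end HolomorphyType.IsPiOne

namespace ExpSpace

theorem exists_exponential (hk : 1 < k) (hΘ : Θ.IsPiOne) (φ : StrongDual ℂ E) :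
    ∃ f : ExpSpace Θ k, (∀ x, f x = Complex.exp (φ x)) ∧
      ∀ j, taylorPoly j f 0 = ((Nat.factorial j : ℂ)⁻¹ • hΘ.pow j φ : Θ.space j) := by
  obtain ⟨K, hK, hpow⟩ := hΘ.exists_thetaNorm_pow_le
  obtain ⟨f, hf, hfx⟩ := exists_taylorPoly_eq hk
    (fun j => ((Nat.factorial j : ℂ)⁻¹ • hΘ.pow j φ : Θ.space j).2) fun ρ hρ => by
      refine Summable.of_nonneg_of_le (fun j => mul_nonneg (mul_nonneg (by positivity)
        (expWeight_nonneg k j)) (Θ.norm_nonneg (Subtype.prop _))) (fun j => ?_)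
        (summable_expWeight_div_factorial hk (r := ρ⁻¹ * (K * ‖φ‖)) (by positivity))
      rw [Submodule.coe_smul, Θ.norm_smul j _ _ (hΘ.pow j φ).2, norm_inv, Complex.norm_natCast,
        mul_pow, inv_pow]
      have h1 := mul_le_mul_of_nonneg_left (hpow j φ) (a := (ρ ^ j)⁻¹ * expWeight k j *
        (Nat.factorial j : ℝ)⁻¹) (mul_nonneg (mul_nonneg (by positivity)
        (expWeight_nonneg k j)) (by positivity))
      refine le_trans (le_of_eq (by ring)) (h1.trans (le_of_eq ?_))
      field_simp
  refine ⟨f, fun x => ?_, hf⟩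
  rw [hfx, Complex.exp_eq_exp_ℂ, NormedSpace.exp_eq_tsum ℂ]
  exact tsum_congr fun j => by simp [HolomorphyType.IsPiOne.pow]

/-- The function `x ↦ e ^ {φ(x)}` as an element of `Exp^k_{Θ,0}(E)`. -/
noncomputable def exponential (hk : 1 < k) (hΘ : Θ.IsPiOne) (φ : StrongDual ℂ E) : ExpSpace Θ k :=
  (exists_exponential hk hΘ φ).choose

theorem exponential_apply (hk : 1 < k) (hΘ : Θ.IsPiOne) (φ : StrongDual ℂ E) (x : E) :
    exponential hk hΘ φ x = Complex.exp (φ x) :=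
  (exists_exponential hk hΘ φ).choose_spec.1 x

theorem taylor_exponential (hk : 1 < k) (hΘ : Θ.IsPiOne) (φ : StrongDual ℂ E) (j : ℕ) :
    taylorPoly j (exponential hk hΘ φ) 0 =
      ((Nat.factorial j : ℂ)⁻¹ • hΘ.pow j φ : Θ.space j) :=
  (exists_exponential hk hΘ φ).choose_spec.2 j

variable (T : ExpSpace Θ k →L[ℂ] ℂ)

theorem hasSum_apply_exponential (hk : 1 < k) (hΘ : Θ.IsPiOne) (φ : StrongDual ℂ E) :
    HasSum (fun j => (Nat.factorial j : ℂ)⁻¹ * T (single hk j (hΘ.pow j φ)))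
      (T (exponential hk hΘ φ)) := by
  convert T.hasSum (hasSum_single hk (exponential hk hΘ φ)) using 1
  funext j
  rw [← smul_eq_mul, ← map_smul, ← map_smul]
  exact congrArg (fun P => T (single hk j P)) (Subtype.ext (taylor_exponential hk hΘ φ j).symm)

/-- The terms of the expansion of `T (e ^ φ)` are dominated by a power series in `‖φ‖` of infinite
radius of convergence. -/
theorem exists_summable_bound (hk : 1 < k) (hΘ : Θ.IsPiOne) :
    ∃ d : ℕ → ℝ, (∀ j, 0 ≤ d j) ∧ (∀ r : ℝ, 0 ≤ r → Summable fun j => d j * r ^ j) ∧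
      ∀ (j : ℕ) (φ : StrongDual ℂ E),
        ‖(Nat.factorial j : ℂ)⁻¹ * T (single hk j (hΘ.pow j φ))‖ ≤ d j * ‖φ‖ ^ j := by
  obtain ⟨K, hK, hpow⟩ := hΘ.exists_thetaNorm_pow_le
  obtain ⟨ρ, hρ, C, hC, hT⟩ := exists_norm_le_expNorm T
  have hw := expWeight_nonneg k
  refine ⟨fun j => C * (expWeight k j / (Nat.factorial j : ℝ) * (ρ⁻¹ * K) ^ j), fun j => ?_,
    fun r hr => ?_, fun j φ => ?_⟩
  · have := hw j
    positivity
  · refine ((summable_expWeight_div_factorial hk (r := ρ⁻¹ * K * r) (by positivity)).mul_left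
      C).congr fun j => ?_
    rw [mul_pow _ r]
    ring
  · rw [norm_mul, norm_inv, Complex.norm_natCast]
    have h1 := hT (single hk j (hΘ.pow j φ))
    rw [expNorm_single] at h1
    have h2 := hw j
    calc (Nat.factorial j : ℝ)⁻¹ * ‖T (single hk j (hΘ.pow j φ))‖
        ≤ (Nat.factorial j : ℝ)⁻¹ * (C * ((ρ ^ j)⁻¹ * expWeight k j * (K * ‖φ‖) ^ j)) := by
          refine mul_le_mul_of_nonneg_left (h1.trans ?_) (by positivity)
          have := hpow j φ
          gcongr
      _ = _ := by
          simp only [mul_pow, inv_pow]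
          ring

theorem differentiable_apply_single_pow (hk : 1 < k) (hΘ : Θ.IsPiOne) (j : ℕ)
    (φ ψ : StrongDual ℂ E) :
    Differentiable ℂ fun z : ℂ => T (single hk j (hΘ.pow j (φ + z • ψ))) := by
  have h : (fun z : ℂ => T (single hk j (hΘ.pow j (φ + z • ψ)))) = fun z : ℂ =>
      ∑ i ∈ Finset.range (j + 1),
        (Lagrange.basis (Finset.range (j + 1)) (fun i : ℕ => (i : ℂ)) i).eval z *
          T (single hk j (hΘ.pow j (φ + (i : ℂ) • ψ))) := by
    funext z
    rw [hΘ.pow_add_smul_eq_sum j φ ψ z]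
    simp only [map_sum, map_smul, smul_eq_mul]
  rw [h]
  exact Differentiable.fun_sum fun i _ => (Polynomial.differentiable _).mul_const _

theorem differentiable_apply_exponential (hk : 1 < k) (hΘ : Θ.IsPiOne) (φ ψ : StrongDual ℂ E) :
    Differentiable ℂ fun z : ℂ => T (exponential hk hΘ (φ + z • ψ)) := by
  obtain ⟨d, hd0, hds, hd⟩ := exists_summable_bound T hk hΘ
  intro z₀
  set R : ℝ := ‖z₀‖ + 1 with hR
  have hR0 : 0 ≤ R := by positivity
  have h : DifferentiableOn ℂ (fun z : ℂ => ∑' j : ℕ, (Nat.factorial j : ℂ)⁻¹ *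
      T (single hk j (hΘ.pow j (φ + z • ψ)))) (Metric.ball 0 R) := by
    refine Complex.differentiableOn_tsum_of_summable_norm
      (hds (‖φ‖ + R * ‖ψ‖) (by positivity)) (fun j => ?_) Metric.isOpen_ball fun j z hz => ?_
    · exact ((differentiable_apply_single_pow T hk hΘ j φ ψ).const_mul _).differentiableOn
    · refine (hd j _).trans ?_
      have := hd0 j
      have hz' : ‖z‖ ≤ R := by simpa using (Metric.mem_ball.1 hz).le
      have h1 : ‖φ + z • ψ‖ ≤ ‖φ‖ + R * ‖ψ‖ := by
        refine (norm_add_le _ _).trans ?_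
        rw [norm_smul]
        gcongr
      gcongr
  simp only [(hasSum_apply_exponential T hk hΘ _).tsum_eq] at h
  exact h.differentiableAt (Metric.isOpen_ball.mem_nhds (by simp [hR]))

theorem exists_norm_apply_exponential_le (hk : 1 < k) (hΘ : Θ.IsPiOne) {R : ℝ} (hR : 0 ≤ R) :
    ∃ M : ℝ, 0 ≤ M ∧ ∀ φ : StrongDual ℂ E, ‖φ‖ ≤ R → ‖T (exponential hk hΘ φ)‖ ≤ M := by
  obtain ⟨d, hd0, hds, hd⟩ := exists_summable_bound T hk hΘ
  refine ⟨∑' j, d j * R ^ j, tsum_nonneg fun j => mul_nonneg (hd0 j) (by positivity),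
    fun φ hφ => ?_⟩
  rw [← (hasSum_apply_exponential T hk hΘ φ).tsum_eq]
  refine tsum_of_norm_bounded (hds R hR).hasSum fun j => (hd j φ).trans ?_
  have := hd0 j
  gcongr

/-- A locally bounded function that is holomorphic along complex lines is continuous: by the Schwarz
lemma on the disc of radius `1 / ‖ψ - φ‖` in the line through `φ` and `ψ`, it is locally
Lipschitz. -/
theorem continuous_apply_exponential (hk : 1 < k) (hΘ : Θ.IsPiOne) :
    Continuous fun φ : StrongDual ℂ E => T (exponential hk hΘ φ) := by
  rw [continuous_iff_continuousAt]
  intro φ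
  obtain ⟨M, hM0, hM⟩ := exists_norm_apply_exponential_le T hk hΘ (R := ‖φ‖ + 1) (by positivity)
  have key : ∀ᶠ ψ in 𝓝 φ, dist (T (exponential hk hΘ ψ)) (T (exponential hk hΘ φ)) ≤
      2 * M * ‖ψ - φ‖ := by
    filter_upwards [Metric.ball_mem_nhds φ one_pos] with ψ hψ
    rw [Metric.mem_ball, dist_eq_norm] at hψ
    rcases eq_or_ne ψ φ with rfl | hne
    · simp
    have h0 : 0 < ‖ψ - φ‖ := norm_pos_iff.2 (sub_ne_zero.2 hne)
    have hline : φ + (0 : ℂ) • (ψ - φ) = φ := by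
      ext x
      simp
    have hmaps : Set.MapsTo (fun z : ℂ => T (exponential hk hΘ (φ + z • (ψ - φ))))
        (Metric.ball 0 (‖ψ - φ‖⁻¹))
        (Metric.closedBall (T (exponential hk hΘ (φ + (0 : ℂ) • (ψ - φ)))) (2 * M)) := by
      intro z hz
      rw [Metric.mem_ball, dist_zero_right, ← one_div, lt_div_iff₀ h0] at hz
      have h1 : ‖T (exponential hk hΘ (φ + z • (ψ - φ)))‖ ≤ M := by
        refine hM _ ((norm_add_le _ _).trans ?_)
        rw [norm_smul]
        gcongr
      have h2 : ‖T (exponential hk hΘ (φ + (0 : ℂ) • (ψ - φ)))‖ ≤ M := by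
        rw [hline]
        exact hM _ (by linarith)
      rw [Metric.mem_closedBall]
      refine (dist_le_norm_add_norm _ _).trans ?_
      linarith
    have h1 := Complex.dist_le_div_mul_dist_of_mapsTo_ball
      (differentiable_apply_exponential T hk hΘ φ (ψ - φ)).differentiableOn hmaps
      (z := 1) (by rw [Metric.mem_ball, dist_zero_right, norm_one]; exact (one_lt_inv₀ h0).2 hψ)
    rw [one_smul, add_sub_cancel, hline] at h1
    simpa using h1
  have hlim : Tendsto (fun ψ => 2 * M * ‖ψ - φ‖) (𝓝 φ) (𝓝 0) := by
    have : Continuous fun ψ : StrongDual ℂ E => 2 * M * ‖ψ - φ‖ := by fun_prop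
    simpa using this.tendsto φ
  exact tendsto_iff_dist_tendsto_zero.2
    (squeeze_zero' (Eventually.of_forall fun _ => dist_nonneg) key hlim)

/-- The exponentials are total. If `T (e ^ {zφ}) = 0` for all `z`, comparing coefficients of powers
of `z` gives `T (φ ^ j) = 0`, so `T` vanishes on polynomials of finite type, by density on all
`P_Θ(^j E)`, and then on Taylor series. -/
theorem eq_zero_of_apply_exponential_eq_zero (hk : 1 < k) (hΘ : Θ.IsPiOne)
    (h : ∀ φ : StrongDual ℂ E, T (exponential hk hΘ φ) = 0) : T = 0 := by
  have h1 : ∀ j φ, T (single hk j (hΘ.pow j φ)) = 0 := by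
    intro j φ
    let p : FormalMultilinearSeries ℂ ℂ ℂ := fun n => ContinuousMultilinearMap.mkPiRing ℂ (Fin n)
      ((Nat.factorial n : ℂ)⁻¹ * T (single hk n (hΘ.pow n φ)))
    have hp : HasFPowerSeriesAt (0 : ℂ → ℂ) p 0 := by
      rw [hasFPowerSeriesAt_iff]
      refine Eventually.of_forall fun z => ?_
      have h2 := hasSum_apply_exponential T hk hΘ (z • φ)
      rw [h] at h2
      rw [zero_add, Pi.zero_apply]
      have h3 : (fun n => z ^ n • p.coeff n) = fun n => (Nat.factorial n : ℂ)⁻¹ *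
          T (single hk n (hΘ.pow n (z • φ))) := by
        funext n
        rw [hΘ.pow_smul, map_smul, map_smul]
        simp [p, FormalMultilinearSeries.coeff]
        ring
      rw [h3]
      exact h2
    have h3 := congrArg (fun q : FormalMultilinearSeries ℂ ℂ ℂ => q.coeff j) hp.eq_zero
    have h4 : ((Nat.factorial j : ℕ) : ℂ) ≠ 0 := by exact_mod_cast Nat.factorial_ne_zero j
    simpa [p, FormalMultilinearSeries.coeff, h4] using h3
  have h2 : ∀ (j : ℕ) (P : Θ.space j), T (single hk j P) = 0 := by
    intro j P
    have hfin : finiteTypePoly E j ≤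
        (LinearMap.ker (T.toLinearMap ∘ₗ single hk j)).map (Θ.space j).subtype := by
      refine Submodule.span_le.2 ?_
      rintro _ ⟨φ, b, rfl⟩
      refine ⟨b • hΘ.pow j φ, ?_, ?_⟩
      · simp [h1]
      · ext x
        simp [HolomorphyType.IsPiOne.pow, mul_comm]
    obtain ⟨ρ, hρ, C, hC, hT⟩ := exists_norm_le_expNorm T
    have hle : ∀ ε > 0, ‖T (single hk j P)‖ ≤ C * ((ρ ^ j)⁻¹ * expWeight k j * ε) := by
      intro ε hε
      obtain ⟨Q, hQ, hPQ⟩ := hΘ.2.2 j P P.2 ε hε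
      obtain ⟨Q, hQ0, rfl⟩ := hfin hQ
      have h3 : T (single hk j Q) = 0 := hQ0
      have h4 : T (single hk j P) = T (single hk j (P - Q)) := by
        rw [map_sub, map_sub, h3, sub_zero]
      rw [h4]
      refine (hT _).trans ?_
      rw [expNorm_single]
      have := expWeight_nonneg k j
      have h5 : Θ.thetaNorm j ((P - Q : Θ.space j) : E → ℂ) ≤ ε := hPQ.le
      gcongr
    have hlim : Tendsto (fun ε : ℝ => C * ((ρ ^ j)⁻¹ * expWeight k j * ε)) (𝓝[>] 0) (𝓝 0) := by
      have : Continuous fun ε : ℝ => C * ((ρ ^ j)⁻¹ * expWeight k j * ε) := by fun_prop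
      simpa using (this.tendsto 0).mono_left nhdsWithin_le_nhds
    exact norm_le_zero_iff.1 (ge_of_tendsto hlim (eventually_mem_nhdsWithin.mono hle))
  ext f
  have h3 := T.hasSum (hasSum_single hk f)
  simp only [h2] at h3
  exact h3.unique hasSum_zero

end ExpSpace

/-- A subspace of a locally convex space is dense if only the zero functional vanishes on it. -/
theorem Submodule.dense_of_forall_dual_eq_zero {X : Type*} [AddCommGroup X] [Module ℂ X]
    [TopologicalSpace X] [IsTopologicalAddGroup X] [ContinuousSMul ℂ X] [LocallyConvexSpace ℝ X]
    (M : Submodule ℂ X) (h : ∀ T : X →L[ℂ] ℂ, (∀ x ∈ M, T x = 0) → T = 0) :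
    Dense (M : Set X) := by
  by_contra hM
  rw [Dense] at hM
  push Not at hM
  obtain ⟨x, hx⟩ := hM
  obtain ⟨T, u, hTu, hux⟩ := RCLike.geometric_hahn_banach_closed_point (𝕜 := ℂ)
    (s := (M.topologicalClosure : Set X)) (M.topologicalClosure.restrictScalars ℝ).convex
    M.isClosed_topologicalClosure hx
  have hT : ∀ y ∈ M, T y = 0 := by
    intro y hy
    by_contra hne
    -- `T` maps a suitable multiple of `y` to `u`, against the separation.
    have h1 := hTu (((u : ℂ) / T y) • y) (M.le_topologicalClosure (M.smul_mem _ hy))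
    simp [hne] at h1
  have h0 := hTu 0 (zero_mem _)
  rw [h T hT] at h0 hux
  simp at h0 hux
  linarith

theorem ExpSpace.dense_span_exponential (hk : 1 < k) (hΘ : Θ.IsPiOne) (S : Set (StrongDual ℂ E))
    (hS : ∀ T : ExpSpace Θ k →L[ℂ] ℂ, (∀ φ ∈ S, T (exponential hk hΘ φ) = 0) →
      ∀ φ, T (exponential hk hΘ φ) = 0) :
    Dense (Submodule.span ℂ (exponential (k := k) hk hΘ '' S) : Set (ExpSpace Θ k)) :=
  Submodule.dense_of_forall_dual_eq_zero _ fun T hT =>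
    eq_zero_of_apply_exponential_eq_zero T hk hΘ (hS T fun _ hφ =>
      hT _ (Submodule.subset_span (Set.mem_image_of_mem _ hφ)))

end Exponential

/-! ### Linear dynamics -/

section Dynamics

/-- Birkhoff's transitivity theorem, for mixing maps. -/
theorem IsMixingMap.isHypercyclicMap {X : Type*} [TopologicalSpace X] [Nonempty X] [BaireSpace X]
    [SecondCountableTopology X] {T : X → X} (hT : Continuous T) (h : IsMixingMap T) :
    IsHypercyclicMap T := by
  have hB := TopologicalSpace.isBasis_countableBasis X
  let G : Set X → Set X := fun V => ⋃ n : ℕ, T^[n] ⁻¹' V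
  have hG : Dense (⋂ V ∈ TopologicalSpace.countableBasis X, G V) := by
    refine dense_biInter_of_isOpen (fun V hV => ?_) (TopologicalSpace.countable_countableBasis X)
      fun V hV => ?_
    · exact isOpen_iUnion fun n => (hB.isOpen hV).preimage (hT.iterate n)
    · rw [dense_iff_inter_open]
      intro U hU hUne
      obtain ⟨n, hn⟩ := h U V hU (hB.isOpen hV) hUne
        (TopologicalSpace.nonempty_of_mem_countableBasis hV)
      obtain ⟨_, ⟨x, hx, rfl⟩, hxV⟩ := hn n le_rfl
      exact ⟨x, hx, Set.mem_iUnion.2 ⟨n, hxV⟩⟩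
  obtain ⟨x, hx⟩ := hG.nonempty
  refine ⟨x, hB.dense_iff.2 fun V hV _ => ?_⟩
  obtain ⟨n, hn⟩ := Set.mem_iUnion.1 (Set.mem_iInter₂.1 hx V hV)
  exact ⟨_, hn, n, rfl⟩

variable {X : Type*} [AddCommGroup X] [Module ℂ X] [TopologicalSpace X]

theorem ContinuousLinearMap.pow_apply_of_apply_eq_smul (L : X →L[ℂ] X) {c : ℂ} {x : X}
    (h : L x = c • x) (n : ℕ) : (L ^ n) x = c ^ n • x := by
  induction n with
  | zero => simp
  | succ n ih =>
    rw [pow_succ', mul_apply_eq_comp, ih, map_smul, h, smul_smul, pow_succ]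

/-- The Godefroy–Shapiro criterion: near `u` in the span of the contracted eigenvectors and `v` in
the span of the expanded ones, `L ^ n (u + wₙ)` tends to `v`, where `wₙ → 0` is the preimage of `v`
under `L ^ n` formed with the inverses of the eigenvalues. -/
theorem isMixingMap_of_dense_span_eigenvectors [IsTopologicalAddGroup X] [ContinuousSMul ℂ X]
    (L : X →L[ℂ] X)
    (hA : Dense (Submodule.span ℂ {x | ∃ c : ℂ, ‖c‖ < 1 ∧ L x = c • x} : Set X))
    (hB : Dense (Submodule.span ℂ {x | ∃ c : ℂ, 1 < ‖c‖ ∧ L x = c • x} : Set X)) :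
    IsMixingMap L := by
  intro U V hU hV hUne hVne
  obtain ⟨u, huU, hu⟩ := hA.inter_open_nonempty U hU hUne
  obtain ⟨v, hvV, hv⟩ := hB.inter_open_nonempty V hV hVne
  have hu0 : Tendsto (fun n : ℕ => (L ^ n) u) atTop (𝓝 0) := by
    refine Submodule.span_induction (p := fun x _ => Tendsto (fun n : ℕ => (L ^ n) x) atTop (𝓝 0))
      ?_ ?_ ?_ ?_ hu
    · rintro x ⟨c, hc, hx⟩
      simp only [L.pow_apply_of_apply_eq_smul hx]
      simpa using (tendsto_pow_atTop_nhds_zero_of_norm_lt_one hc).smul_const x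
    · simp only [map_zero]
      exact tendsto_const_nhds
    · intro x y _ _ hx hy
      simpa only [map_add, add_zero] using hx.add hy
    · intro a x _ hx
      simpa only [map_smul, smul_zero] using hx.const_smul a
  obtain ⟨w, hw0, hw⟩ : ∃ w : ℕ → X, Tendsto w atTop (𝓝 0) ∧ ∀ n, (L ^ n) (w n) = v := by
    refine Submodule.span_induction (p := fun x _ => ∃ w : ℕ → X, Tendsto w atTop (𝓝 0) ∧
      ∀ n, (L ^ n) (w n) = x) ?_ ?_ ?_ ?_ hv
    · rintro x ⟨c, hc, hx⟩
      have hc0 : c ≠ 0 := norm_pos_iff.1 (one_pos.trans hc)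
      refine ⟨fun n => c⁻¹ ^ n • x, ?_, fun n => ?_⟩
      · have : ‖c⁻¹‖ < 1 := by
          rw [norm_inv]
          exact inv_lt_one_of_one_lt₀ hc
        simpa using (tendsto_pow_atTop_nhds_zero_of_norm_lt_one this).smul_const x
      · rw [map_smul, L.pow_apply_of_apply_eq_smul hx, smul_smul, ← mul_pow,
          inv_mul_cancel₀ hc0, one_pow, one_smul]
    · exact ⟨0, tendsto_const_nhds, fun n => by simp⟩
    · rintro x y _ _ ⟨w, hw0, hw⟩ ⟨w', hw0', hw'⟩
      exact ⟨fun n => w n + w' n, by simpa using hw0.add hw0', fun n => by rw [map_add, hw, hw']⟩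
    · rintro a x _ ⟨w, hw0, hw⟩
      exact ⟨fun n => a • w n, by simpa using hw0.const_smul a, fun n => by rw [map_smul, hw]⟩
  have h1 : ∀ᶠ n in atTop, u + w n ∈ U := by
    have : Tendsto (fun n => u + w n) atTop (𝓝 u) := by simpa using hw0.const_add u
    exact this.eventually_mem (hU.mem_nhds huU)
  have h2 : ∀ᶠ n in atTop, (L ^ n) u + v ∈ V := by
    have : Tendsto (fun n => (L ^ n) u + v) atTop (𝓝 v) := by simpa using hu0.add_const v
    exact this.eventually_mem (hV.mem_nhds hvV)
  obtain ⟨N, hN⟩ := eventually_atTop.1 (h1.and h2)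
  refine ⟨N, fun n hn => ⟨(L ^ n) u + v, ⟨u + w n, (hN n hn).1, ?_⟩, (hN n hn).2⟩⟩
  have hit : (L ^ n) (u + w n) = L^[n] (u + w n) := by simp
  rw [← hit, map_add, hw]

end Dynamics

/-! ### Convolution operators -/

section Convolution

variable {E : Type*} [NormedAddCommGroup E] [NormedSpace ℂ E]
variable {Θ : HolomorphyType E} {k : ℝ≥0∞}

open ExpSpace

/-- A functional that vanishes on `e ^ φ` for `φ` in a non-empty open set vanishes on all
exponentials, by the identity theorem on the lines through a point of that set. -/
theorem ExpSpace.dense_span_exponential_of_isOpen (hk : 1 < k) (hΘ : Θ.IsPiOne)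
    {S : Set (StrongDual ℂ E)} (hS : IsOpen S) (hne : S.Nonempty) :
    Dense (Submodule.span ℂ (exponential (k := k) hk hΘ '' S) : Set (ExpSpace Θ k)) := by
  refine dense_span_exponential hk hΘ S fun T hT φ => ?_
  obtain ⟨φ₀, h₀⟩ := hne
  have hd := differentiable_apply_exponential T hk hΘ φ₀ (φ - φ₀)
  have hev : (fun z : ℂ => T (exponential hk hΘ (φ₀ + z • (φ - φ₀)))) =ᶠ[𝓝 0] fun _ => 0 := by
    have hc : Continuous fun z : ℂ => φ₀ + z • (φ - φ₀) := by fun_prop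
    have hmem : S ∈ 𝓝 (φ₀ + (0 : ℂ) • (φ - φ₀)) := by
      have hline : φ₀ + (0 : ℂ) • (φ - φ₀) = φ₀ := by
        ext x
        simp
      rw [hline]
      exact hS.mem_nhds h₀
    filter_upwards [hc.continuousAt.eventually_mem hmem] with z hz
    exact hT _ hz
  have h := AnalyticOnNhd.eq_of_eventuallyEq (fun z _ => hd.analyticAt z)
    (analyticOnNhd_const (s := Set.univ)) hev
  have h1 := congrFun h 1
  rwa [one_smul, add_sub_cancel] at h1

theorem ExpSpace.separableSpace [TopologicalSpace.SeparableSpace (StrongDual ℂ E)] (hk : 1 < k)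
    (hΘ : Θ.IsPiOne) : TopologicalSpace.SeparableSpace (ExpSpace Θ k) := by
  obtain ⟨D, hDc, hD⟩ := TopologicalSpace.exists_countable_dense (StrongDual ℂ E)
  have h := dense_span_exponential (Θ := Θ) hk hΘ D fun T hT φ =>
    congrFun ((continuous_apply_exponential T hk hΘ).ext_on hD continuous_const
      fun φ hφ => hT φ hφ) φ
  have hs := ((hDc.image (exponential hk hΘ)).isSeparable.span (R := ℂ)).closure
  rw [h.closure_eq] at hs
  exact TopologicalSpace.isSeparable_univ_iff.1 hs

namespace IsConvolutionOperator

variable {L : ExpSpace Θ k →L[ℂ] ExpSpace Θ k}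

/-- `g = L (e ^ φ)` solves `dg(x) a = φ(a) g(x)`, so that `g e ^ {-φ}` is constant. -/
theorem apply_exponential (hL : IsConvolutionOperator L) (hk : 1 < k) (hΘ : Θ.IsPiOne)
    (φ : StrongDual ℂ E) :
    L (exponential hk hΘ φ) = (L (exponential hk hΘ φ)) 0 • exponential hk hΘ φ := by
  set g := L (exponential hk hΘ φ) with hg
  have hexp : ∀ x, HasFDerivAt (fun y => Complex.exp (φ y)) (Complex.exp (φ x) • φ) x :=
    fun x => φ.hasFDerivAt.cexp
  have hfd : ∀ x a, fderiv ℂ g x a = φ a * g x := by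
    intro x a
    rw [hg, ← hL a (exponential hk hΘ φ) (φ a • exponential hk hΘ φ) (fun y => ?_) x, map_smul,
      toFun_smul]
    · rfl
    · rw [funext (exponential_apply hk hΘ φ), (hexp y).fderiv, toFun_smul]
      simp [exponential_apply, mul_comm]
  have hdiff : ∀ x, HasFDerivAt (fun y => g y * Complex.exp ((-φ) y)) (0 : E →L[ℂ] ℂ) x := by
    intro x
    have h1 := (g.analytic x trivial).differentiableAt.hasFDerivAt.mul
      ((-φ).hasFDerivAt (x := x)).cexp
    refine h1.congr_fderiv ?_
    ext a
    simp [hfd]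
    ring
  refine toFun_injective (funext fun x => ?_)
  have h2 := is_const_of_fderiv_eq_zero (𝕜 := ℂ) (fun y => (hdiff y).differentiableAt)
    (fun y => (hdiff y).fderiv) x 0
  rw [toFun_smul, Pi.smul_apply, exponential_apply, smul_eq_mul]
  simp only [neg_apply, map_zero, Complex.exp_zero, mul_one] at h2
  rw [← h2, mul_assoc, ← Complex.exp_add, neg_add_cancel, Complex.exp_zero, mul_one]

/-- The symbol `φ ↦ L (e ^ φ) (0)` of `L`: for a convolution operator, the eigenvalue of `e ^ φ`. -/
noncomputable def symbol (L : ExpSpace Θ k →L[ℂ] ExpSpace Θ k) (hk : 1 < k) (hΘ : Θ.IsPiOne)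
    (φ : StrongDual ℂ E) : ℂ := ((evalZero Θ k).comp L) (exponential hk hΘ φ)

theorem apply_exponential_eq_symbol_smul (hL : IsConvolutionOperator L) (hk : 1 < k)
    (hΘ : Θ.IsPiOne) (φ : StrongDual ℂ E) :
    L (exponential hk hΘ φ) = symbol L hk hΘ φ • exponential hk hΘ φ :=
  hL.apply_exponential hk hΘ φ

theorem exists_eq_smul_of_symbol_const (hL : IsConvolutionOperator L) (hk : 1 < k)
    (hΘ : Θ.IsPiOne) (h : ∀ φ ψ, symbol L hk hΘ φ = symbol L hk hΘ ψ) :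
    ∃ c : ℂ, ∀ f : ExpSpace Θ k, L f = c • f := by
  have := t2Space (Θ := Θ) hk
  refine ⟨symbol L hk hΘ 0, fun f => ?_⟩
  have hd := dense_span_exponential_of_isOpen (Θ := Θ) hk hΘ isOpen_univ Set.univ_nonempty
  have hc : L = symbol L hk hΘ 0 • ContinuousLinearMap.id ℂ (ExpSpace Θ k) := by
    refine ContinuousLinearMap.ext_on hd ?_
    rintro _ ⟨φ, -, rfl⟩
    rw [hL.apply_exponential_eq_symbol_smul hk hΘ, h φ 0]
    rfl
  exact congrArg (fun M : ExpSpace Θ k →L[ℂ] ExpSpace Θ k => M f) hc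

/-- Liouville's theorem on complex lines, for the symbol or for its inverse. -/
theorem symbol_const_of_bounded (hk : 1 < k) (hΘ : Θ.IsPiOne)
    (h : (∀ φ, ‖symbol L hk hΘ φ‖ ≤ 1) ∨ ∀ φ, 1 ≤ ‖symbol L hk hΘ φ‖) (φ ψ : StrongDual ℂ E) :
    symbol L hk hΘ φ = symbol L hk hΘ ψ := by
  have hd : Differentiable ℂ fun z : ℂ => symbol L hk hΘ (φ + z • (ψ - φ)) :=
    differentiable_apply_exponential _ hk hΘ φ (ψ - φ)
  have h01 : symbol L hk hΘ (φ + (0 : ℂ) • (ψ - φ)) = symbol L hk hΘ (φ + (1 : ℂ) • (ψ - φ)) := by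
    rcases h with h | h
    · refine hd.apply_eq_apply_of_bounded ?_ 0 1
      exact (Metric.isBounded_closedBall (x := (0 : ℂ)) (r := 1)).subset
        (Set.range_subset_iff.2 fun z => by simpa using h _)
    · have hne : ∀ χ, symbol L hk hΘ χ ≠ 0 := fun χ =>
        norm_pos_iff.1 (one_pos.trans_le (h χ))
      refine inv_injective ((hd.inv fun z => hne _).apply_eq_apply_of_bounded ?_ 0 1)
      refine (Metric.isBounded_closedBall (x := (0 : ℂ)) (r := 1)).subset
        (Set.range_subset_iff.2 fun z => ?_)
      simpa using inv_le_one_of_one_le₀ (h _)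
  have hline : φ + (0 : ℂ) • (ψ - φ) = φ := by
    ext x
    simp
  rwa [hline, one_smul, add_sub_cancel] at h01

theorem isMixingMap (hL : IsConvolutionOperator L) (hk : 1 < k) (hΘ : Θ.IsPiOne)
    (hne : ¬ ∃ c : ℂ, ∀ f : ExpSpace Θ k, L f = c • f) : IsMixingMap L := by
  have hcont : Continuous (symbol L hk hΘ) := continuous_apply_exponential _ hk hΘ
  have hnc : ¬ ∀ φ ψ, symbol L hk hΘ φ = symbol L hk hΘ ψ := fun h =>
    hne (hL.exists_eq_smul_of_symbol_const hk hΘ h)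
  refine isMixingMap_of_dense_span_eigenvectors L ?_ ?_
  · have hA : {φ | ‖symbol L hk hΘ φ‖ < 1}.Nonempty := by
      by_contra h
      rw [Set.not_nonempty_iff_eq_empty, Set.eq_empty_iff_forall_notMem] at h
      exact hnc (symbol_const_of_bounded hk hΘ (Or.inr fun φ => not_lt.1 (h φ)))
    refine (dense_span_exponential_of_isOpen hk hΘ (isOpen_lt hcont.norm continuous_const)
      hA).mono (Submodule.span_mono ?_)
    rintro _ ⟨φ, hφ, rfl⟩
    exact ⟨_, hφ, hL.apply_exponential_eq_symbol_smul hk hΘ φ⟩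
  · have hA : {φ | 1 < ‖symbol L hk hΘ φ‖}.Nonempty := by
      by_contra h
      rw [Set.not_nonempty_iff_eq_empty, Set.eq_empty_iff_forall_notMem] at h
      exact hnc (symbol_const_of_bounded hk hΘ (Or.inl fun φ => not_lt.1 (h φ)))
    refine (dense_span_exponential_of_isOpen hk hΘ (isOpen_lt continuous_const hcont.norm)
      hA).mono (Submodule.span_mono ?_)
    rintro _ ⟨φ, hφ, rfl⟩
    exact ⟨_, hφ, hL.apply_exponential_eq_symbol_smul hk hΘ φ⟩

end IsConvolutionOperator
end Convolution

theorem theorem4p1 {E : Type*} [NormedAddCommGroup E] [NormedSpace ℂ E] [CompleteSpace E]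
    [TopologicalSpace.SeparableSpace (StrongDual ℂ E)]
    (k : ℝ≥0∞) (hk : 1 < k) (Θ : HolomorphyType E) (hΘ : Θ.IsPiOne)
    (L : ExpSpace Θ k →L[ℂ] ExpSpace Θ k) (hL : IsConvolutionOperator L)
    (hL_nontrivial : ¬ ∃ c : ℂ, ∀ f : ExpSpace Θ k, L f = c • f) :
    IsMixingMap L ∧ IsHypercyclicMap L := by
  have hmix := hL.isMixingMap hk hΘ hL_nontrivial
  have := ExpSpace.isCompletelyPseudoMetrizableSpace (Θ := Θ) hk
  have := ExpSpace.separableSpace (Θ := Θ) hk hΘ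
  have : SecondCountableTopology (ExpSpace Θ k) := by
    let _ := TopologicalSpace.upgradeIsCompletelyPseudoMetrizable (ExpSpace Θ k)
    exact UniformSpace.secondCountable_of_separable _
  exact ⟨hmix, hmix.isHypercyclicMap L.continuous⟩
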